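/- **Notation.** All spaces are Euclidean, and $\overline{\mathbb R}=[-\infty,\infty]$. For $\varphi:\mathbb R^n\to\overline{\mathbb R}$ finite at $\bar x$, the regular subdifferential is $$\hat\partial\varphi(\bar x)=\Big\{v \;\Big|\; \liminf_{x\to\bar x,\;x\ne\bar x}\frac{\varphi(x)-\varphi(\bar x)-\langle v,x-\bar x\rangle}{\|x-\bar x\|}\ge 0\Big\}.$$ The basic subdifferential $\partial\varphi(\bar x)$ is the set of limits of sequences $v_k\in\hat\partial\varphi(x_k)$ with $x_k\to\bar x$ and $\varphi(x_k)\to\varphi(\bar x)$. The singular subdifferential $\partial^\infty\varphi(\bar x)$ is the set of limits of sequences $\lambda_kv_k$ with $\lambda_k\downarrow 0$ and $x_k,v_k$ as before. All three sets are empty where $\varphi$ is not finite. For $\Omega\subset\mathbb R^n$ and $\bar x\in\Omega$, $\hat N(\bar x;\Omega)$ is the set of $v$ with $\limsup_{x\to\bar x,\;x\in\Omega\setminus\{\bar x\}}\langle v,x-\bar x\rangle/\|x-\bar x\|\le 0$, and $N(\bar x;\Omega)$ is the set of limits of sequences $v_k\in\hat N(x_k;\Omega)$ with $x_k\in\Omega$,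 $x_k\to\bar x$. The coderivative of a set-valued mapping $F$ at $(\bar x,\bar y)\in\operatorname{gph}F$ is $D^*F(\bar x,\bar y)(v)=\{u\mid (u,-v)\in N((\bar x,\bar y);\operatorname{gph}F)\}$, and $\partial^2\varphi(\bar x,\bar y)(u)=(D^*\partial\varphi)(\bar x,\bar y)(u)$ for $\bar y\in\partial\varphi(\bar x)$. For $\varphi:\mathbb R^n\times\mathbb R^d\to\overline{\mathbb R}$ let $\varphi_w=\varphi(\cdot,w)$ and $\partial_x\varphi(x,w)=\partial\varphi_w(x)$. For $\bar y\in\partial_x\varphi(\bar x,\bar w)$ the partial and the extended partial second-order subdifferentials are $$\partial^2_x\varphi(\bar x,\bar w,\bar y)(u)=\partial^2\varphi_{\bar w}(\bar x,\bar y)(u)\subset\mathbb R^n,\qquad \tilde\partial^2_x\varphi(\bar x,\bar w,\bar y)(u)=(D^*\partial_x\varphi)(\bar x,\bar w,\bar y)(u)\subset\mathbb R^n\times\mathbb R^d,$$ where in the second one the coderivative is that of the mapping $(x,w)\mapsto\partial_x\varphi(x,w)$. A proper function $\varphi:\mathbb R^n\times\mathbb R^d\to\overline{\mathbb R}$ is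 strongly amenable in $x$ at $\bar x$ with compatible parametrization in $w$ at $\bar w$, with representation $(h,\theta)$, if on a neighborhood of $(\bar x,\bar w)$ one has $\varphi(x,w)=\theta(h(x,w))$, where $h$ is of class $C^2$ there with values in $\mathbb R^m$, $\theta:\mathbb R^m\to\overline{\mathbb R}$ is proper, lower semicontinuous and convex, and $$\partial^\infty\theta(h(\bar x,\bar w))\cap\ker\nabla_xh(\bar x,\bar w)^*=\{0\}.$$ **Theorem 3.3 (second-order chain rules for strongly amenable compositions).** Let $\varphi$ be strongly amenable in $x$ at $\bar x$ with compatible parametrization in $w$ at $\bar w$, with representation $(h,\theta)$, and let $\bar y\in\partial_x\varphi(\bar x,\bar w)$. Put $\bar z=h(\bar x,\bar w)$ and $$M(\bar x,\bar w,\bar y)=\{v\in\partial\theta(\bar z)\mid \nabla_xh(\bar x,\bar w)^*v=\bar y\}.$$ Assume the second-order qualification condition $$\partial^2\theta(\bar z,v)(0)\cap\ker\nabla_xh(\bar x,\bar w)^*=\{0\}\quad\text{for all } v\in M(\bar x,\bar w,\bar y).$$ Then $M(\bar x,\bar w,\bar y)\neq\emptyset$, and for every $u\in\mathbb R^n$ $$\partial^2_x\varphi(\bar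 x,\bar w,\bar y)(u)\subset\bigcup_{v\in M(\bar x,\bar w,\bar y)}\Big(\nabla^2_{xx}\langle v,h\rangle(\bar x,\bar w)u+\nabla_xh(\bar x,\bar w)^*\,\partial^2\theta(\bar z,v)\big(\nabla_xh(\bar x,\bar w)u\big)\Big),$$ $$\tilde\partial^2_x\varphi(\bar x,\bar w,\bar y)(u)\subset\bigcup_{v\in M(\bar x,\bar w,\bar y)}\Big\{\Big(\nabla^2_{xx}\langle v,h\rangle(\bar x,\bar w)u+\nabla_xh(\bar x,\bar w)^*p,\ \nabla^2_{xw}\langle v,h\rangle(\bar x,\bar w)u+\nabla_wh(\bar x,\bar w)^*p\Big)\ \Big|\ p\in\partial^2\theta(\bar z,v)\big(\nabla_xh(\bar x,\bar w)u\big)\Big\}.$$ Here $\nabla^2_{xw}\langle v,h\rangle(\bar x,\bar w)u\in\mathbb R^d$ is the derivative at $x=\bar x$, in the direction $u$, of $x\mapsto\nabla_w\langle v,h\rangle(x,\bar w)$. -/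

import Mathlib

open Filter Topology

noncomputable section

namespace VarAnal

section FirstOrder

variable {E : Type*} [NormedAddCommGroup E] [InnerProductSpace ℝ E]

/-- An extended-real-valued function is finite at a point. -/
def FiniteAt {X : Type*} (φ : X → EReal) (x : X) : Prop := φ x ≠ ⊥ ∧ φ x ≠ ⊤

/-- Proper functions: nowhere `-∞` and not identically `+∞`. -/
def IsProper {X : Type*} (φ : X → EReal) : Prop := (∀ x, φ x ≠ ⊥) ∧ ∃ x, φ x ≠ ⊤

/-- Convexity of an extended-real-valued function: its epigraph is convex. -/
def IsConvexFun (θ : E → EReal) : Prop := Convex ℝ {p : E × ℝ | θ p.1 ≤ (p.2 : EReal)}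

/-- The regular (Fréchet) subdifferential at points where `φ` is finite:
`liminf_{x → x̄, x ≠ x̄} (φ x - φ x̄ - ⟪v, x - x̄⟫) / ‖x - x̄‖ ≥ 0`, written out with `ε`.
It is empty at points where `φ` is not finite. -/
def regSubdiff (φ : E → EReal) (xbar : E) : Set E :=
  {v | FiniteAt φ xbar ∧ ∀ ε : ℝ, 0 < ε → ∀ᶠ x in 𝓝 xbar,
    φ xbar + ((inner ℝ v (x - xbar) - ε * ‖x - xbar‖ : ℝ) : EReal) ≤ φ x}

/-- The basic (limiting, Mordukhovich) subdifferential: limits of regular subgradients at points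
`x_k → x̄` with `φ x_k → φ x̄`. -/
def subdiff (φ : E → EReal) (xbar : E) : Set E :=
  {v | FiniteAt φ xbar ∧ ∃ (x : ℕ → E) (y : ℕ → E),
    Tendsto x atTop (𝓝 xbar) ∧ Tendsto (fun k => φ (x k)) atTop (𝓝 (φ xbar)) ∧
    (∀ k, y k ∈ regSubdiff φ (x k)) ∧ Tendsto y atTop (𝓝 v)}

/-- The singular (horizontal) subdifferential: limits of `λ_k v_k` with `λ_k ↓ 0`, `x_k → x̄`,
`φ x_k → φ x̄` and `v_k` a regular subgradient at `x_k`. -/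
def singSubdiff (φ : E → EReal) (xbar : E) : Set E :=
  {v | FiniteAt φ xbar ∧ ∃ (l : ℕ → ℝ) (x : ℕ → E) (y : ℕ → E),
    (∀ k, 0 < l k) ∧ Tendsto l atTop (𝓝 0) ∧
    Tendsto x atTop (𝓝 xbar) ∧ Tendsto (fun k => φ (x k)) atTop (𝓝 (φ xbar)) ∧
    (∀ k, y k ∈ regSubdiff φ (x k)) ∧ Tendsto (fun k => l k • y k) atTop (𝓝 v)}

/-- The regular normal cone to `Ω` at `x̄ ∈ Ω`:
`limsup_{x → x̄, x ∈ Ω} ⟪v, x - x̄⟫ / ‖x - x̄‖ ≤ 0`, written out with `ε`. -/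
def regNormalCone (Ω : Set E) (xbar : E) : Set E :=
  {v | xbar ∈ Ω ∧ ∀ ε : ℝ, 0 < ε → ∀ᶠ x in 𝓝[Ω] xbar, inner ℝ v (x - xbar) ≤ ε * ‖x - xbar‖}

/-- The basic (limiting) normal cone to `Ω` at `x̄ ∈ Ω`. -/
def normalCone (Ω : Set E) (xbar : E) : Set E :=
  {v | xbar ∈ Ω ∧ ∃ (x : ℕ → E) (y : ℕ → E), (∀ k, x k ∈ Ω) ∧ Tendsto x atTop (𝓝 xbar) ∧
    (∀ k, y k ∈ regNormalCone Ω (x k)) ∧ Tendsto y atTop (𝓝 v)}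

end FirstOrder

section SecondOrder

variable {E : Type*} [NormedAddCommGroup E] [InnerProductSpace ℝ E]
variable {W : Type*} [NormedAddCommGroup W] [InnerProductSpace ℝ W]
variable {F : Type*} [NormedAddCommGroup F] [InnerProductSpace ℝ F]

/-- The graph of a set-valued mapping, in the product with its Euclidean structure. -/
def setGraph (S : E → Set F) : Set (WithLp 2 (E × F)) := {p | p.snd ∈ S p.fst}

/-- The coderivative `D^*S(x̄, ȳ)(v) = {u | (u, -v) ∈ N((x̄, ȳ); gph S)}`. -/
def coderivative (S : E → Set F) (xbar : E) (ybar : F) (v : F) : Set E :=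
  {u | WithLp.toLp 2 (u, -v) ∈ normalCone (setGraph S) (WithLp.toLp 2 (xbar, ybar))}

/-- The second-order subdifferential `∂²φ(x̄, ȳ)(u) = (D^*∂φ)(x̄, ȳ)(u)`. -/
def subdiff2 (φ : E → EReal) (xbar ybar u : E) : Set E :=
  coderivative (subdiff φ) xbar ybar u

/-- The partial subdifferential `∂ₓφ(x, w) = ∂φ_w(x)`, where `φ_w = φ(·, w)`. -/
def partialSubdiff (φ : E × W → EReal) (x : E) (w : W) : Set E :=
  subdiff (fun x' => φ (x', w)) x

/-- The partial second-order subdifferential `∂²ₓφ(x̄, w̄, ȳ)(u) = ∂²φ_w̄(x̄, ȳ)(u)`. -/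
def partialSubdiff2 (φ : E × W → EReal) (xbar : E) (wbar : W) (ybar u : E) : Set E :=
  subdiff2 (fun x => φ (x, wbar)) xbar ybar u

/-- The extended partial second-order subdifferential `(D^*∂ₓφ)(x̄, w̄, ȳ)(u)`: the coderivative
of the mapping `(x, w) ↦ ∂ₓφ(x, w)`. -/
def extPartialSubdiff2 (φ : E × W → EReal) (xbar : E) (wbar : W) (ybar u : E) :
    Set (WithLp 2 (E × W)) :=
  coderivative (fun q : WithLp 2 (E × W) => partialSubdiff φ q.fst q.snd)
    (WithLp.toLp 2 (xbar, wbar)) ybar u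

end SecondOrder

section Composition

variable {E : Type*} [NormedAddCommGroup E] [InnerProductSpace ℝ E] [CompleteSpace E]
variable {W : Type*} [NormedAddCommGroup W] [InnerProductSpace ℝ W] [CompleteSpace W]
variable {Z : Type*} [NormedAddCommGroup Z] [InnerProductSpace ℝ Z] [CompleteSpace Z]

/-- The partial Jacobian `∇ₓh(x, w)`. -/
def derivX (h : E × W → Z) (x : E) (w : W) : E →L[ℝ] Z := fderiv ℝ (fun x' => h (x', w)) x

/-- The partial Jacobian `∇_w h(x, w)`. -/
def derivW (h : E × W → Z) (x : E) (w : W) : W →L[ℝ] Z := fderiv ℝ (fun w' => h (x, w')) w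

/-- The transposed Jacobian `∇ₓh(x, w)^*`. -/
def adjX (h : E × W → Z) (x : E) (w : W) : Z →L[ℝ] E := (derivX h x w).adjoint

/-- The transposed Jacobian `∇_w h(x, w)^*`. -/
def adjW (h : E × W → Z) (x : E) (w : W) : Z →L[ℝ] W := (derivW h x w).adjoint

/-- `∇²ₓₓ⟨v, h⟩(x, w) u`: the derivative in `x`, in the direction `u`, of the partial gradient
`∇ₓ⟨v, h⟩`. -/
def hessXX (h : E × W → Z) (v : Z) (x : E) (w : W) (u : E) : E :=
  fderiv ℝ (fun x' => gradient (fun x'' => inner ℝ v (h (x'', w))) x') x u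

/-- `∇²ₓ_w⟨v, h⟩(x, w) u`: the derivative in `x`, in the direction `u`, of the partial gradient
`∇_w⟨v, h⟩`; it is a vector of the parameter space. -/
def hessXW (h : E × W → Z) (v : Z) (x : E) (w : W) (u : E) : W :=
  fderiv ℝ (fun x' => gradient (fun w' => inner ℝ v (h (x', w'))) w) x u

/-- `φ` is strongly amenable in `x` at `x̄` with compatible parametrization in `w` at `w̄`, through
the representation `φ = θ ∘ h` near `(x̄, w̄)`. -/
structure StronglyAmenableVia (φ : E × W → EReal) (h : E × W → Z) (θ : Z → EReal)
    (xbar : E) (wbar : W) : Prop where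
  proper : IsProper φ
  exists_nhds : ∃ V ∈ 𝓝 (xbar, wbar), ContDiffOn ℝ 2 h V ∧ ∀ q ∈ V, φ q = θ (h q)
  outer_proper : IsProper θ
  outer_lsc : LowerSemicontinuous θ
  outer_convex : IsConvexFun θ
  qualification : singSubdiff θ (h (xbar, wbar)) ∩ {v | adjX h xbar wbar v = 0} = {0}

/-- The set of multipliers `M(x̄, w̄, ȳ) = {v ∈ ∂θ(h(x̄, w̄)) | ∇ₓh(x̄, w̄)^* v = ȳ}`. -/
def multipliers (h : E × W → Z) (θ : Z → EReal) (xbar : E) (wbar : W) (ybar : E) : Set Z :=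
  {v | v ∈ subdiff θ (h (xbar, wbar)) ∧ adjX h xbar wbar v = ybar}

end Composition

end VarAnal

end

/-!
The graph of `(x, w) ↦ ∂ₓφ(x, w)` is, near the reference point, the set of all
`(x, w, ∇ₓh(x, w)^* v)` with `v ∈ ∂θ(h(x, w))`. In other words it is the image, under the `C¹` map
`G (p, v) = (p, ∇ₓh(p)^* v)`, of the preimage of `gph ∂θ` under the `C¹` map `H (p, v) = (h p, v)`.
The second-order chain rules are the calculus of normals to such a set, with the derivatives of `G`
and `H` written out.

The graph description (`StronglyAmenableVia.exists_chain_rule`) holds with multipliers `v` bounded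
by the subgradients they produce, uniformly around the reference point. Indeed, normals to the
domain of `θ` are singular subgradients (`mem_singSubdiff_of_normal_dom`), so a blow-up of the
multipliers would contradict the first-order qualification condition (`exists_subgradient_bound`).
As `θ` is convex and lower semicontinuous, the graph of `∂θ` is closed, even without convergence of
the values of `θ` (`isSubgradientAt_of_tendsto`); hence limits of multipliers are multipliers.

Every chain rule rests on one approximate rule that needs neither convexity nor a qualification
condition, `exists_regSubdiff_approx_of_comp`: regular subgradients of `θ ∘ g` are approximated by
`∇g(x')^* v` with `v` a regular subgradient of `θ` at a nearby point. It comes from decoupling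
`z = g x` by a quadratic penalty. Applied to `θ` itself it gives the first-order rule; applied to
the indicator function of `gph ∂θ` it describes regular normals to the preimage under `H`. Regular
normals to the image under `G` simply pull back (`adjoint_mem_regNormalCone`). In the passage to the
limit (`exists_normal_of_image_preimage`) the bound on the multipliers yields a limit point of the
fibre, and the second-order qualification condition, which says that `∇H^*` has no kernel on the
normal cone to `gph ∂θ`, keeps the approximate normals bounded.

Both inclusions are instances of `exists_of_mem_coderivative_adjoint_image`, with parameter `p = x`
and `p = (x, w)` respectively. The derivative of `p ↦ ⟨v, ∇ₓh(p) u⟩` is the Hessian term, by the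
symmetry of the second derivative of `h` (`inner_hessXX`, `inner_hessXW`).
-/

noncomputable section

namespace VarAnal

/-! ### Extended-real-valued functions through real upper bounds -/

theorem coe_le_iff_forall_real {r : ℝ} {t : EReal} :
    (r : EReal) ≤ t ↔ ∀ c : ℝ, t ≤ c → r ≤ c := by
  constructor
  · intro h c hc
    exact_mod_cast h.trans hc
  · intro h
    induction t with
    | bot =>
      have := h (r - 1) bot_le
      linarith
    | coe t => exact_mod_cast h t le_rfl
    | top => exact le_top

theorem eq_coe_of_ne_bot_of_le {t : EReal} {a : ℝ} (hb : t ≠ ⊥) (ha : t ≤ a) :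
    ∃ b : ℝ, t = b ∧ b ≤ a := by
  induction t with
  | bot => exact absurd rfl hb
  | coe t => exact ⟨t, rfl, by exact_mod_cast ha⟩
  | top => exact absurd (top_le_iff.1 ha) (EReal.coe_ne_top a)

theorem FiniteAt.exists_coe {X : Type*} {φ : X → EReal} {x : X} (h : FiniteAt φ x) :
    ∃ a : ℝ, φ x = a :=
  ⟨(φ x).toReal, (EReal.coe_toReal h.2 h.1).symm⟩

theorem finiteAt_of_eq_coe {X : Type*} {φ : X → EReal} {x : X} {a : ℝ} (h : φ x = a) :
    FiniteAt φ x :=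
  ⟨h ▸ EReal.coe_ne_bot a, h ▸ EReal.coe_ne_top a⟩

/-- A lower semicontinuous function that never takes the value `-∞`, perturbed by a continuous real
function, attains its minimum on a compact set that meets its domain. -/
theorem exists_min_add {X : Type*} [TopologicalSpace X] {f : X → EReal} {r : X → ℝ} {K : Set X}
    (hf : LowerSemicontinuous f) (hbot : ∀ x, f x ≠ ⊥) (hr : ContinuousOn r K) (hK : IsCompact K)
    {x₀ : X} (hx₀ : x₀ ∈ K) {a : ℝ} (ha : f x₀ = a) :
    ∃ x₁ ∈ K, ∃ b : ℝ, f x₁ = b ∧ ∀ x ∈ K, ∀ c : ℝ, f x ≤ c → b + r x₁ ≤ c + r x := by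
  have hlsc : LowerSemicontinuousOn (fun x => f x + (r x : EReal)) K := by
    refine LowerSemicontinuousOn.add' (hf.lowerSemicontinuousOn K)
      (ContinuousOn.lowerSemicontinuousOn (continuous_coe_real_ereal.comp_continuousOn hr)) ?_
    intro x _
    exact EReal.continuousAt_add (Or.inr (EReal.coe_ne_bot _)) (Or.inr (EReal.coe_ne_top _))
  obtain ⟨x₁, hx₁, hmin⟩ := hlsc.exists_isMinOn ⟨x₀, hx₀⟩ hK
  have h0 : f x₁ + (r x₁ : EReal) ≤ ((a + r x₀ : ℝ) : EReal) := by
    have := hmin hx₀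
    simpa [ha] using this
  obtain ⟨b, hb⟩ : ∃ b : ℝ, f x₁ = b := by
    have h1 := hbot x₁
    generalize f x₁ = t at h0 h1
    induction t with
    | bot => exact absurd rfl h1
    | coe t => exact ⟨t, rfl⟩
    | top =>
      rw [EReal.top_add_coe] at h0
      exact absurd (top_le_iff.1 h0) (EReal.coe_ne_top _)
  refine ⟨x₁, hx₁, b, hb, fun x hx c hc => ?_⟩
  have h1 : f x₁ + (r x₁ : EReal) ≤ f x + (r x : EReal) := hmin hx
  rw [hb] at h1
  have h2 : ((b + r x₁ : ℝ) : EReal) ≤ ((c + r x : ℝ) : EReal) := by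
    push_cast
    exact h1.trans (add_le_add_left hc _)
  exact_mod_cast h2

/-- Sequential form of the closedness of the epigraph of a lower semicontinuous function. -/
theorem le_of_tendsto_of_lowerSemicontinuous {X ι : Type*} [TopologicalSpace X] {f : X → EReal}
    (hf : LowerSemicontinuous f) {l : Filter ι} [l.NeBot] {x : ι → X} {c : ι → ℝ} {x₀ : X} {c₀ : ℝ}
    (hx : Tendsto x l (𝓝 x₀)) (hc : Tendsto c l (𝓝 c₀)) (h : ∀ᶠ i in l, f (x i) ≤ c i) :
    f x₀ ≤ c₀ := by
  have h1 : Tendsto (fun i => (x i, (c i : EReal))) l (𝓝 (x₀, (c₀ : EReal))) :=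
    hx.prodMk_nhds ((continuous_coe_real_ereal.tendsto c₀).comp hc)
  exact hf.isClosed_epigraph.mem_of_tendsto h1 h

section Regular

variable {E : Type*} [NormedAddCommGroup E] [InnerProductSpace ℝ E]

theorem mem_regSubdiff_iff {φ : E → EReal} {x : E} {a : ℝ} (ha : φ x = a) {v : E} :
    v ∈ regSubdiff φ x ↔ ∀ ε : ℝ, 0 < ε → ∀ᶠ x' in 𝓝 x, ∀ c : ℝ, φ x' ≤ c →
      a + inner ℝ v (x' - x) - ε * ‖x' - x‖ ≤ c := by
  have key : ∀ ε : ℝ, ∀ x', (φ x + ((inner ℝ v (x' - x) - ε * ‖x' - x‖ : ℝ) : EReal) ≤ φ x') ↔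
      ∀ c : ℝ, φ x' ≤ c → a + inner ℝ v (x' - x) - ε * ‖x' - x‖ ≤ c := by
    intro ε x'
    rw [ha, ← EReal.coe_add, coe_le_iff_forall_real, ← add_sub_assoc]
  constructor
  · rintro ⟨_, h⟩ ε hε
    exact (h ε hε).mono fun x' hx' => (key ε x').1 hx'
  · intro h
    exact ⟨finiteAt_of_eq_coe ha, fun ε hε => (h ε hε).mono fun x' hx' => (key ε x').2 hx'⟩

/-- A proximal subgradient is a regular subgradient. -/
theorem mem_regSubdiff_of_proximal {φ : E → EReal} {x : E} {a : ℝ} (ha : φ x = a) {v : E} (k : ℝ)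
    (h : ∀ᶠ x' in 𝓝 x, ∀ c : ℝ, φ x' ≤ c → a + inner ℝ v (x' - x) - k * ‖x' - x‖ ^ 2 ≤ c) :
    v ∈ regSubdiff φ x := by
  rw [mem_regSubdiff_iff ha]
  intro ε hε
  have h1 : Tendsto (fun x' => k * ‖x' - x‖) (𝓝 x) (𝓝 0) := by
    have : Continuous fun x' => k * ‖x' - x‖ := by fun_prop
    simpa using this.tendsto x
  filter_upwards [h, h1.eventually (gt_mem_nhds hε)] with x' hx' hk c hc
  have h2 : k * ‖x' - x‖ * ‖x' - x‖ ≤ ε * ‖x' - x‖ :=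
    mul_le_mul_of_nonneg_right hk.le (norm_nonneg _)
  have := hx' c hc
  nlinarith

/-- A minimizer of `φ + k ‖p - ·‖²` carries the regular subgradient `2 k (p - x)`. -/
theorem smul_sub_mem_regSubdiff_of_min {φ : E → EReal} {x p : E} {a k : ℝ} (ha : φ x = a)
    (h : ∀ᶠ x' in 𝓝 x, ∀ c : ℝ, φ x' ≤ c → a + k * ‖p - x‖ ^ 2 ≤ c + k * ‖p - x'‖ ^ 2) :
    (2 * k) • (p - x) ∈ regSubdiff φ x := by
  refine mem_regSubdiff_of_proximal ha k ?_
  filter_upwards [h] with x' hx' c hc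
  have h1 : ‖p - x'‖ ^ 2 = ‖p - x‖ ^ 2 - 2 * inner ℝ (p - x) (x' - x) + ‖x' - x‖ ^ 2 := by
    rw [← norm_sub_sq_real]
    congr 2
    abel
  have := hx' c hc
  rw [h1] at this
  rw [real_inner_smul_left]
  linarith

/-- A one-sided Lipschitz-type bound at a point bounds the derivative there. -/
theorem norm_fderiv_le_of_neg_le {s : E → ℝ} {s' : E →L[ℝ] ℝ} {x : E} {c : ℝ} (hc : 0 ≤ c)
    (hs : HasFDerivAt s s' x) (h : ∀ᶠ x' in 𝓝 x, -(c * ‖x' - x‖) ≤ s x' - s x) : ‖s'‖ ≤ c := by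
  have key : ∀ d : E, -(c * ‖d‖) ≤ s' d := by
    intro d
    have h1 : Tendsto (fun t : ℝ => x + t • d) (𝓝[>] 0) (𝓝 x) := by
      have : Continuous fun t : ℝ => x + t • d := by fun_prop
      have := (this.tendsto 0).mono_left (nhdsWithin_le_nhds (s := Set.Ioi 0))
      simpa using this
    have h2 : Tendsto (fun t : ℝ => t⁻¹ • (s (x + t • d) - s x)) (𝓝[>] 0) (𝓝 (s' d)) := by
      have := (hs.hasLineDerivAt d).tendsto_slope_zero
      exact this.mono_left (nhdsWithin_mono _ fun t ht => ne_of_gt ht)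
    refine ge_of_tendsto h2 ?_
    filter_upwards [h1.eventually h, self_mem_nhdsWithin] with t ht ht0
    have ht0 : 0 < t := ht0
    rw [add_sub_cancel_left, norm_smul, Real.norm_of_nonneg ht0.le] at ht
    rw [smul_eq_mul, inv_mul_eq_div, le_div_iff₀ ht0]
    linarith
  refine s'.opNorm_le_bound hc fun d => ?_
  rw [Real.norm_eq_abs, abs_le]
  refine ⟨key d, ?_⟩
  have := key (-d)
  rw [norm_neg, map_neg] at this
  linarith

end Regular

/-! ### The approximate chain rule for regular subgradients -/

section ApproximateChainRule

variable {X : Type*} [NormedAddCommGroup X] [InnerProductSpace ℝ X] [FiniteDimensional ℝ X]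
variable {Z : Type*} [NormedAddCommGroup Z] [InnerProductSpace ℝ Z] [FiniteDimensional ℝ Z]

/-- Approximate chain rule: a regular subgradient `y` of `θ ∘ g` at `x` is approximated by
`∇g(x')^* v` with `v` a regular subgradient of `θ` at a point `z` near `g x`, and `x'` near `x`.
No qualification condition is needed: the constraint `z = g x'` is decoupled by a quadratic penalty,
and `v` is the scaled residual of that penalty. -/
theorem exists_regSubdiff_approx_of_comp {θ : Z → EReal} (hθ : LowerSemicontinuous θ)
    (hbot : ∀ z, θ z ≠ ⊥) {g : X → Z} {x : X} (hg : ∀ᶠ x' in 𝓝 x, DifferentiableAt ℝ g x') {y : X}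
    (hy : y ∈ regSubdiff (fun x' => θ (g x')) x) {ε : ℝ} (hε : 0 < ε) :
    ∃ x' z v, dist x' x < ε ∧ dist z (g x) < ε ∧ v ∈ regSubdiff θ z ∧
      ‖(fderiv ℝ g x').adjoint v - y‖ ≤ ε := by
  obtain ⟨a, ha⟩ := hy.1.exists_coe
  have hreg := (mem_regSubdiff_iff (φ := fun x' => θ (g x')) ha).1 hy (ε / 2) (half_pos hε)
  obtain ⟨δ₀, hδ₀, hball⟩ := Metric.nhds_basis_closedBall.eventually_iff.1 (hg.and hreg)
  obtain ⟨δ, hδ, hδδ₀, hδε⟩ : ∃ δ : ℝ, 0 < δ ∧ δ ≤ δ₀ ∧ δ ≤ ε / 4 :=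
    ⟨min δ₀ (ε / 4), lt_min hδ₀ (by linarith), min_le_left _ _, min_le_right _ _⟩
  have hB : ∀ x' ∈ Metric.closedBall x δ, DifferentiableAt ℝ g x' ∧ ∀ c : ℝ, θ (g x') ≤ c →
      a + inner ℝ y (x' - x) - ε / 2 * ‖x' - x‖ ≤ c :=
    fun x' hx' => hball (Metric.closedBall_subset_closedBall hδδ₀ hx')
  set K : Set (X × Z) := Metric.closedBall x δ ×ˢ Metric.closedBall (g x) δ with hKdef
  have hK : IsCompact K := (isCompact_closedBall x δ).prod (isCompact_closedBall (g x) δ)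
  have hcontg : ContinuousOn (fun q : X × Z => g q.1) K := fun q hq =>
    ((hB q.1 hq.1).1.continuousAt.comp (f := Prod.fst) continuousAt_fst).continuousWithinAt
  have hxK : (x, g x) ∈ K :=
    ⟨Metric.mem_closedBall_self hδ.le, Metric.mem_closedBall_self hδ.le⟩
  -- the penalized problems, with penalty parameter `n + 1`
  have hex : ∀ n : ℕ, ∃ q ∈ K, ∃ b : ℝ, θ q.2 = b ∧ ∀ p ∈ K, ∀ c : ℝ, θ p.2 ≤ c →
      b + (-inner ℝ y (q.1 - x) + ε / 2 * ‖q.1 - x‖ + ‖q.1 - x‖ ^ 2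
        + (n + 1) * ‖g q.1 - q.2‖ ^ 2) ≤
      c + (-inner ℝ y (p.1 - x) + ε / 2 * ‖p.1 - x‖ + ‖p.1 - x‖ ^ 2
        + (n + 1) * ‖g p.1 - p.2‖ ^ 2) := by
    intro n
    refine exists_min_add (f := fun q : X × Z => θ q.2)
      (r := fun q : X × Z => -inner ℝ y (q.1 - x) + ε / 2 * ‖q.1 - x‖ + ‖q.1 - x‖ ^ 2
        + (n + 1) * ‖g q.1 - q.2‖ ^ 2)
      (hθ.comp continuous_snd) (fun q => hbot q.2) ?_ hK hxK ha
    exact (Continuous.continuousOn (by fun_prop)).add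
      (continuousOn_const.mul ((hcontg.sub continuousOn_snd).norm.pow 2))
  choose q hqK b hb hmin using hex
  obtain ⟨_, _, b₀, _, hb₀⟩ := exists_min_add (r := fun _ => 0) hθ hbot continuousOn_const
    (isCompact_closedBall (g x) δ) (Metric.mem_closedBall_self hδ.le) ha
  have hval : ∀ n, b n + (-inner ℝ y ((q n).1 - x) + ε / 2 * ‖(q n).1 - x‖ + ‖(q n).1 - x‖ ^ 2
        + (n + 1) * ‖g (q n).1 - (q n).2‖ ^ 2) ≤ a := by
    intro n
    have := hmin n (x, g x) hxK a ha.le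
    simpa using this
  obtain ⟨⟨x₁, z₁⟩, hq₁K, ψ, hψ, hlim⟩ := hK.tendsto_subseq hqK
  have hlim1 : Tendsto (fun n => (q (ψ n)).1) atTop (𝓝 x₁) :=
    (continuous_fst.tendsto _).comp hlim
  have hlim2 : Tendsto (fun n => (q (ψ n)).2) atTop (𝓝 z₁) :=
    (continuous_snd.tendsto _).comp hlim
  -- the residual of the penalty tends to zero, so that the limit is feasible
  have hz₁ : g x₁ = z₁ := by
    have h1 : ∀ n, ‖g (q n).1 - (q n).2‖ ^ 2 ≤ (a - b₀ + ‖y‖ * δ) * (1 / ((n : ℝ) + 1)) := by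
      intro n
      have hn : (0 : ℝ) < (n : ℝ) + 1 := by positivity
      rw [mul_one_div, le_div_iff₀ hn]
      have h2 := hval n
      have h3 : b₀ ≤ b n := by simpa using hb₀ (q n).2 (hqK n).2 (b n) (hb n).le
      have h4 : inner ℝ y ((q n).1 - x) ≤ ‖y‖ * δ :=
        (real_inner_le_norm _ _).trans
          (mul_le_mul_of_nonneg_left (mem_closedBall_iff_norm.1 (hqK n).1) (norm_nonneg _))
      have h5 : 0 ≤ ε / 2 * ‖(q n).1 - x‖ := by positivity
      nlinarith [sq_nonneg ‖(q n).1 - x‖]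
    have h2 : Tendsto (fun n => (a - b₀ + ‖y‖ * δ) * (1 / ((ψ n : ℝ) + 1))) atTop (𝓝 0) := by
      have := (tendsto_one_div_add_atTop_nhds_zero_nat (𝕜 := ℝ)).comp hψ.tendsto_atTop
      simpa [Function.comp_def] using this.const_mul (a - b₀ + ‖y‖ * δ)
    have h3 : Tendsto (fun n => ‖g (q (ψ n)).1 - (q (ψ n)).2‖ ^ 2) atTop (𝓝 (‖g x₁ - z₁‖ ^ 2)) :=
      (((hB x₁ hq₁K.1).1.continuousAt.tendsto.comp hlim1).sub hlim2).norm.pow 2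
    have h4 := le_of_tendsto_of_tendsto' h3 h2 fun n => h1 (ψ n)
    have h5 : ‖g x₁ - z₁‖ = 0 := by
      by_contra hne
      have : 0 < ‖g x₁ - z₁‖ ^ 2 := by positivity
      linarith
    exact sub_eq_zero.1 (norm_eq_zero.1 h5)
  -- the limit competes in the regular subgradient inequality, hence is `x` itself
  have hx₁ : x₁ = x := by
    have h1 : Tendsto (fun n => a + inner ℝ y ((q (ψ n)).1 - x) - ε / 2 * ‖(q (ψ n)).1 - x‖
        - ‖(q (ψ n)).1 - x‖ ^ 2) atTop
        (𝓝 (a + inner ℝ y (x₁ - x) - ε / 2 * ‖x₁ - x‖ - ‖x₁ - x‖ ^ 2)) := by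
      have hc : Continuous fun x' : X =>
          a + inner ℝ y (x' - x) - ε / 2 * ‖x' - x‖ - ‖x' - x‖ ^ 2 := by fun_prop
      exact (hc.tendsto x₁).comp hlim1
    have h2 := le_of_tendsto_of_lowerSemicontinuous hθ hlim2 h1 (Eventually.of_forall fun n => by
      rw [hb]
      have h3 := hval (ψ n)
      have h4 : 0 ≤ ((ψ n : ℝ) + 1) * ‖g (q (ψ n)).1 - (q (ψ n)).2‖ ^ 2 := by positivity
      exact_mod_cast by linarith)
    rw [← hz₁] at h2
    have h3 := (hB x₁ hq₁K.1).2 _ h2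
    have h5 : ‖x₁ - x‖ = 0 := by
      by_contra hne
      have : 0 < ‖x₁ - x‖ ^ 2 := by positivity
      linarith
    exact sub_eq_zero.1 (norm_eq_zero.1 h5)
  subst hx₁
  subst hz₁
  obtain ⟨N, hN1, hN2⟩ := ((hlim1.eventually (Metric.ball_mem_nhds _ hδ)).and
    (hlim2.eventually (Metric.ball_mem_nhds _ hδ))).exists
  generalize ψ N = n at hN1 hN2
  obtain ⟨hdiff, -⟩ := hB _ (hqK n).1
  refine ⟨(q n).1, (q n).2, (2 * ((n : ℝ) + 1)) • (g (q n).1 - (q n).2), ?_, ?_, ?_, ?_⟩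
  · exact (Metric.mem_ball.1 hN1).trans_le (by linarith)
  · exact (Metric.mem_ball.1 hN2).trans_le (by linarith)
  · refine smul_sub_mem_regSubdiff_of_min (hb n) ?_
    filter_upwards [Metric.isOpen_ball.mem_nhds hN2] with z hz c hc
    have := hmin n ((q n).1, z) ⟨(hqK n).1, Metric.ball_subset_closedBall hz⟩ c hc
    simp only at this
    linarith
  · have hs : HasFDerivAt (fun x' => -inner ℝ y (x' - x₁) + ‖x' - x₁‖ ^ 2
        + ((n : ℝ) + 1) * ‖g x' - (q n).2‖ ^ 2)
        (-(innerSL ℝ y) + 2 • (innerSL ℝ ((q n).1 - x₁)).comp (ContinuousLinearMap.id ℝ X)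
          + ((n : ℝ) + 1) • (2 • (innerSL ℝ (g (q n).1 - (q n).2)).comp (fderiv ℝ g (q n).1)))
        (q n).1 := by
      have h1 : HasFDerivAt (fun x' : X => x' - x₁) (ContinuousLinearMap.id ℝ X) (q n).1 :=
        (hasFDerivAt_id _).sub_const _
      have h2 : HasFDerivAt (fun x' : X => inner ℝ y (x' - x₁)) (innerSL ℝ y) (q n).1 :=
        ((innerSL ℝ y).hasFDerivAt.comp _ h1)
      exact (h2.neg.add h1.norm_sq).add
        ((hdiff.hasFDerivAt.sub_const (q n).2).norm_sq.const_mul ((n : ℝ) + 1))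
    have h1 := norm_fderiv_le_of_neg_le (half_pos hε).le hs (by
      filter_upwards [Metric.isOpen_ball.mem_nhds hN1] with x' hx'
      have h2 := hmin n (x', (q n).2) ⟨Metric.ball_subset_closedBall hx', (hqK n).2⟩ _ (hb n).le
      simp only at h2
      have h3 : ‖x' - x₁‖ - ‖(q n).1 - x₁‖ ≤ ‖x' - (q n).1‖ := by
        have := norm_sub_norm_le (x' - x₁) ((q n).1 - x₁)
        simpa using this
      nlinarith)
    set v := (2 * ((n : ℝ) + 1)) • (g (q n).1 - (q n).2) with hv
    have h2 : (-(innerSL ℝ y) + 2 • (innerSL ℝ ((q n).1 - x₁)).comp (ContinuousLinearMap.id ℝ X)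
          + ((n : ℝ) + 1) • (2 • (innerSL ℝ (g (q n).1 - (q n).2)).comp (fderiv ℝ g (q n).1))) =
        innerSL ℝ ((fderiv ℝ g (q n).1).adjoint v - y + (2 : ℝ) • ((q n).1 - x₁)) := by
      ext d
      simp [hv, ContinuousLinearMap.adjoint_inner_left]
      ring
    rw [h2, innerSL_apply_norm] at h1
    have h3 : ‖(2 : ℝ) • ((q n).1 - x₁)‖ ≤ 2 * (ε / 4) := by
      rw [norm_smul, Real.norm_of_nonneg (by norm_num)]
      have := (mem_ball_iff_norm.1 hN1).le
      linarith
    have h4 := norm_sub_le ((fderiv ℝ g (q n).1).adjoint v - y + (2 : ℝ) • ((q n).1 - x₁))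
      ((2 : ℝ) • ((q n).1 - x₁))
    rw [add_sub_cancel_right] at h4
    linarith

end ApproximateChainRule

/-! ### Subgradients of convex functions -/

section Convex

variable {Z : Type*} [NormedAddCommGroup Z] [InnerProductSpace ℝ Z]

/-- Subgradients in the sense of convex analysis, at points where `θ` is finite; the global
subgradient inequality is tested on real upper bounds of the values of `θ`. -/
def IsSubgradientAt (θ : Z → EReal) (z v : Z) : Prop :=
  ∃ a : ℝ, θ z = a ∧ ∀ (z' : Z) (c : ℝ), θ z' ≤ c → a + inner ℝ v (z' - z) ≤ c

theorem IsSubgradientAt.mem_regSubdiff {θ : Z → EReal} {z v : Z} (h : IsSubgradientAt θ z v) :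
    v ∈ regSubdiff θ z := by
  obtain ⟨a, ha, h⟩ := h
  refine (mem_regSubdiff_iff ha).2 fun ε hε => Eventually.of_forall fun z' c hc => ?_
  have := h z' c hc
  have : 0 ≤ ε * ‖z' - z‖ := by positivity
  linarith

theorem IsConvexFun.isSubgradientAt {θ : Z → EReal} (hθ : IsConvexFun θ) {z v : Z}
    (hv : v ∈ regSubdiff θ z) : IsSubgradientAt θ z v := by
  obtain ⟨a, ha⟩ := hv.1.exists_coe
  refine ⟨a, ha, fun z' c hc => ?_⟩
  rw [mem_regSubdiff_iff ha] at hv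
  refine le_of_forall_pos_le_add fun ε hε => ?_
  have hpos : 0 < ε / (‖z' - z‖ + 1) := by positivity
  have h1 : Tendsto (fun t : ℝ => z + t • (z' - z)) (𝓝[>] 0) (𝓝 z) := by
    have : Continuous fun t : ℝ => z + t • (z' - z) := by fun_prop
    have := (this.tendsto 0).mono_left (nhdsWithin_le_nhds (s := Set.Ioi 0))
    simpa using this
  obtain ⟨t, ht, ht0, ht1⟩ := ((h1.eventually (hv _ hpos)).and
    (Ioo_mem_nhdsGT (zero_lt_one' ℝ))).exists
  have hconv : θ (z + t • (z' - z)) ≤ (((1 - t) * a + t * c : ℝ) : EReal) := by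
    have h2 := hθ (x := (z, a)) (y := (z', c)) ha.le hc (a := 1 - t) (b := t) (by linarith)
      ht0.le (by ring)
    have h3 : (1 - t) • z + t • z' = z + t • (z' - z) := by module
    simpa [h3] using h2
  have h4 := ht _ hconv
  rw [add_sub_cancel_left, inner_smul_right, norm_smul, Real.norm_of_nonneg ht0.le] at h4
  have h5 : ε / (‖z' - z‖ + 1) * ‖z' - z‖ ≤ ε := by
    rw [div_mul_eq_mul_div, div_le_iff₀ (by positivity)]
    nlinarith
  have h6 : t * (a + inner ℝ v (z' - z)) ≤ t * (c + ε) := by nlinarith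
  exact le_of_mul_le_mul_left h6 ht0

/-- The graph of the convex subdifferential of a proper lower semicontinuous function is closed; no
convergence of the values of `θ` has to be assumed. -/
theorem isSubgradientAt_of_tendsto {ι : Type*} {l : Filter ι} [l.NeBot] {θ : Z → EReal}
    (hproper : IsProper θ) (hlsc : LowerSemicontinuous θ) {z v : ι → Z} {z₀ v₀ : Z}
    (hz : Tendsto z l (𝓝 z₀)) (hv : Tendsto v l (𝓝 v₀))
    (h : ∀ᶠ i in l, IsSubgradientAt θ (z i) (v i)) : IsSubgradientAt θ z₀ v₀ := by
  have key : ∀ (z' : Z) (c : ℝ), θ z' ≤ c → θ z₀ ≤ ((c - inner ℝ v₀ (z' - z₀) : ℝ) : EReal) := by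
    intro z' c hc
    refine le_of_tendsto_of_lowerSemicontinuous hlsc hz
      (tendsto_const_nhds.sub (hv.inner (tendsto_const_nhds.sub hz))) ?_
    filter_upwards [h] with i hi
    obtain ⟨a, ha, hi⟩ := hi
    rw [ha]
    exact_mod_cast by linarith [hi z' c hc]
  obtain ⟨z', hz'⟩ := hproper.2
  obtain ⟨a, ha, -⟩ := eq_coe_of_ne_bot_of_le (hproper.1 z₀)
    (key z' _ (EReal.coe_toReal hz' (hproper.1 z')).symm.le)
  refine ⟨a, ha, fun z' c hc => ?_⟩
  have := key z' c hc
  rw [ha] at this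
  have : a ≤ c - inner ℝ v₀ (z' - z₀) := by exact_mod_cast this
  linarith

/-- For a proper lower semicontinuous convex function, the basic subdifferential is the one of
convex analysis. -/
theorem mem_subdiff_iff_isSubgradientAt {θ : Z → EReal} (hproper : IsProper θ)
    (hlsc : LowerSemicontinuous θ) (hconv : IsConvexFun θ) {z v : Z} :
    v ∈ subdiff θ z ↔ IsSubgradientAt θ z v := by
  constructor
  · rintro ⟨_, x, y, hx, _, hy, hyv⟩
    exact isSubgradientAt_of_tendsto hproper hlsc hx hyv
      (Eventually.of_forall fun k => hconv.isSubgradientAt (hy k))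
  · intro h
    refine ⟨?_, fun _ => z, fun _ => v, tendsto_const_nhds, tendsto_const_nhds,
      fun _ => h.mem_regSubdiff, tendsto_const_nhds⟩
    obtain ⟨a, ha, -⟩ := h
    exact finiteAt_of_eq_coe ha

theorem isClosed_setGraph_subdiff {θ : Z → EReal} (hproper : IsProper θ)
    (hlsc : LowerSemicontinuous θ) (hconv : IsConvexFun θ) :
    IsClosed (setGraph (subdiff θ)) := by
  refine IsSeqClosed.isClosed fun p p₀ hp hlim => ?_
  refine (mem_subdiff_iff_isSubgradientAt hproper hlsc hconv).2 ?_
  refine isSubgradientAt_of_tendsto hproper hlsc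
    ((WithLp.prod_continuous_ofLp 2 Z Z).fst.tendsto p₀ |>.comp hlim)
    ((WithLp.prod_continuous_ofLp 2 Z Z).snd.tendsto p₀ |>.comp hlim)
    (Eventually.of_forall fun k => (mem_subdiff_iff_isSubgradientAt hproper hlsc hconv).1 (hp k))

/-- Normals to the domain of a lower semicontinuous function are singular subgradients.
The regular subgradients that realize `v` come from the minimizers of `θ + k ‖· - (z + v)‖²` as
`k → ∞`: they tend to the projection of `z + v` on the domain, which is `z`. -/
theorem mem_singSubdiff_of_normal_dom [FiniteDimensional ℝ Z] {θ : Z → EReal}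
    (hbot : ∀ z, θ z ≠ ⊥) (hlsc : LowerSemicontinuous θ) {z v : Z} (hz : FiniteAt θ z)
    (hv : ∀ z', θ z' ≠ ⊤ → inner ℝ v (z' - z) ≤ 0) : v ∈ singSubdiff θ z := by
  obtain ⟨a, ha⟩ := hz.exists_coe
  have hex : ∀ n : ℕ, ∃ q ∈ Metric.closedBall z 1, ∃ b : ℝ, θ q = b ∧
      ∀ p ∈ Metric.closedBall z 1, ∀ c : ℝ, θ p ≤ c →
        b + ((n : ℝ) + 1) * ‖z + v - q‖ ^ 2 ≤ c + ((n : ℝ) + 1) * ‖z + v - p‖ ^ 2 := fun n =>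
    exists_min_add hlsc hbot (Continuous.continuousOn (by fun_prop)) (isCompact_closedBall z 1)
      (Metric.mem_closedBall_self zero_le_one) ha
  choose q hqK b hb hmin using hex
  obtain ⟨_, _, b₀, _, hb₀⟩ := exists_min_add (r := fun _ => 0) hlsc hbot continuousOn_const
    (isCompact_closedBall z 1) (Metric.mem_closedBall_self zero_le_one) ha
  have hval : ∀ n, b n + ((n : ℝ) + 1) * ‖q n - z‖ ^ 2 ≤ a := by
    intro n
    have h1 := hmin n z (Metric.mem_closedBall_self zero_le_one) a ha.le
    have h2 : ‖z + v - q n‖ ^ 2 = ‖v‖ ^ 2 - 2 * inner ℝ v (q n - z) + ‖q n - z‖ ^ 2 := by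
      rw [← norm_sub_sq_real]
      congr 2
      abel
    have h3 := hv (q n) (by rw [hb]; exact EReal.coe_ne_top _)
    rw [h2, add_sub_cancel_left] at h1
    have hn : (0 : ℝ) < (n : ℝ) + 1 := by positivity
    nlinarith
  have hqz : Tendsto q atTop (𝓝 z) := by
    have h1 : ∀ n, ‖q n - z‖ ^ 2 ≤ (a - b₀) * (1 / ((n : ℝ) + 1)) := by
      intro n
      rw [mul_one_div, le_div_iff₀ (by positivity)]
      have h2 : b₀ ≤ b n := by simpa using hb₀ (q n) (hqK n) (b n) (hb n).le
      linarith [hval n]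
    have h2 : Tendsto (fun n : ℕ => (a - b₀) * (1 / ((n : ℝ) + 1))) atTop (𝓝 0) := by
      simpa using (tendsto_one_div_add_atTop_nhds_zero_nat (𝕜 := ℝ)).const_mul (a - b₀)
    have h3 := (squeeze_zero (fun n => sq_nonneg ‖q n - z‖) h1 h2).sqrt
    rw [tendsto_iff_norm_sub_tendsto_zero]
    simpa using h3
  have hθq : Tendsto (fun n => θ (q n)) atTop (𝓝 (θ z)) := by
    refine tendsto_order.2 ⟨fun c hc => hqz.eventually (hlsc z c hc), fun c hc => ?_⟩
    refine Eventually.of_forall fun n => lt_of_le_of_lt ?_ hc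
    rw [ha, hb]
    have h1 : 0 ≤ ((n : ℝ) + 1) * ‖q n - z‖ ^ 2 := by positivity
    exact_mod_cast by linarith [hval n]
  obtain ⟨N, hN⟩ := eventually_atTop.1 (hqz.eventually (Metric.ball_mem_nhds z one_pos))
  have hshift := tendsto_add_atTop_nat N
  refine ⟨hz, fun n => (2 * (((n + N : ℕ) : ℝ) + 1))⁻¹, fun n => q (n + N),
    fun n => (2 * (((n + N : ℕ) : ℝ) + 1)) • (z + v - q (n + N)), fun n => by positivity, ?_,
    hqz.comp hshift, hθq.comp hshift, fun n => ?_, ?_⟩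
  · have h1 := ((tendsto_one_div_add_atTop_nhds_zero_nat (𝕜 := ℝ)).const_mul (1 / 2)).comp hshift
    rw [mul_zero] at h1
    refine h1.congr fun n => ?_
    simp only [Function.comp_apply]
    rw [mul_inv]
    ring
  · refine smul_sub_mem_regSubdiff_of_min (hb _) ?_
    filter_upwards [Metric.isOpen_ball.mem_nhds (hN (n + N) (Nat.le_add_left N n))] with p hp c hc
    exact hmin _ p (Metric.ball_subset_closedBall hp) c hc
  · have h1 : Tendsto (fun n => z + v - q (n + N)) atTop (𝓝 v) := by
      simpa using (tendsto_const_nhds (x := z + v)).sub (hqz.comp hshift)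
    refine h1.congr fun n => ?_
    rw [inv_smul_smul₀ (by positivity)]

/-- Directions in which the convex subgradients blow up are normal to the domain. -/
theorem inner_nonpos_of_tendsto_normalized {θ : Z → EReal} (hproper : IsProper θ)
    (hlsc : LowerSemicontinuous θ) {z v : ℕ → Z} {t : ℕ → ℝ} {z₀ v₀ : Z}
    (hz : Tendsto z atTop (𝓝 z₀)) (ht0 : ∀ k, 0 < t k) (ht : Tendsto t atTop (𝓝 0))
    (hv : Tendsto (fun k => t k • v k) atTop (𝓝 v₀))
    (h : ∀ k, IsSubgradientAt θ (z k) (v k)) {z' : Z} (hz' : θ z' ≠ ⊤) :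
    inner ℝ v₀ (z' - z₀) ≤ 0 := by
  obtain ⟨c, hc⟩ := FiniteAt.exists_coe ⟨hproper.1 z', hz'⟩
  -- lower semicontinuity bounds the values `θ (z k)` from below
  obtain ⟨m, hm⟩ : ∃ m : ℝ, (m : EReal) < θ z₀ := by
    obtain ⟨m, -, hm⟩ := EReal.lt_iff_exists_real_btwn.1 (bot_lt_iff_ne_bot.2 (hproper.1 z₀))
    exact ⟨m, hm⟩
  have h1 : Tendsto (fun k => inner ℝ (t k • v k) (z' - z k)) atTop (𝓝 (inner ℝ v₀ (z' - z₀))) :=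
    hv.inner (tendsto_const_nhds.sub hz)
  have h2 : Tendsto (fun k => t k * (c - m)) atTop (𝓝 0) := by
    simpa using ht.mul_const (c - m)
  refine le_of_tendsto_of_tendsto h1 h2 ?_
  filter_upwards [hz.eventually (hlsc z₀ _ hm)] with k hk
  obtain ⟨a, ha, hsub⟩ := h k
  have h3 := hsub z' c hc.le
  have h4 : m < a := by
    rw [ha] at hk
    exact_mod_cast hk
  rw [real_inner_smul_left]
  exact mul_le_mul_of_nonneg_left (by linarith) (ht0 k).le

end Convex

/-! ### The first-order chain rule, uniformly in the parameter -/

theorem tendsto_clm_apply {E F ι : Type*} [NormedAddCommGroup E] [NormedSpace ℝ E]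
    [NormedAddCommGroup F] [NormedSpace ℝ F] {l : Filter ι} {A : ι → E →L[ℝ] F} {v : ι → E}
    {A₀ : E →L[ℝ] F} {v₀ : E} (hA : Tendsto A l (𝓝 A₀)) (hv : Tendsto v l (𝓝 v₀)) :
    Tendsto (fun i => A i (v i)) l (𝓝 (A₀ v₀)) :=
  (isBoundedBilinearMap_apply.continuous.tendsto (A₀, v₀)).comp (hA.prodMk_nhds hv)

theorem continuousAt_adjoint {E F T : Type*} [NormedAddCommGroup E] [InnerProductSpace ℝ E]
    [CompleteSpace E] [NormedAddCommGroup F] [InnerProductSpace ℝ F] [CompleteSpace F]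
    [TopologicalSpace T] {B : T → E →L[ℝ] F} {t : T} (hB : ContinuousAt B t) :
    ContinuousAt (fun s => (B s).adjoint) t :=
  (ContinuousLinearMap.adjoint (𝕜 := ℝ) (E := E) (F := F)).continuous.continuousAt.comp hB

section FirstOrderChainRule

variable {E : Type*} [NormedAddCommGroup E] [InnerProductSpace ℝ E]

theorem regSubdiff_congr {φ ψ : E → EReal} {x : E} (h : φ =ᶠ[𝓝 x] ψ) :
    regSubdiff φ x = regSubdiff ψ x := by
  ext v
  have hx : φ x = ψ x := h.self_of_nhds
  simp only [regSubdiff, FiniteAt, Set.mem_ofPred_eq, hx]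
  refine and_congr_right fun _ => forall₂_congr fun ε _ => ?_
  exact eventually_congr (h.mono fun x' hx' => by rw [hx'])

theorem regSubdiff_subset_subdiff (φ : E → EReal) (x : E) : regSubdiff φ x ⊆ subdiff φ x :=
  fun v hv => ⟨hv.1, fun _ => x, fun _ => v, tendsto_const_nhds, tendsto_const_nhds,
    fun _ => hv, tendsto_const_nhds⟩

variable {Z : Type*} [NormedAddCommGroup Z] [InnerProductSpace ℝ Z] [FiniteDimensional ℝ Z]
variable {P : Type*} [PseudoMetricSpace P]

/-- The first-order qualification condition at `p₀` bounds the subgradients of `θ` by their images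
under `A p`, uniformly around `(p₀, z₀)`: a sequence violating the bound, once normalized, would
produce a nonzero normal to the domain of `θ` in the kernel of `A p₀`. -/
theorem exists_subgradient_bound {θ : Z → EReal} (hproper : IsProper θ)
    (hlsc : LowerSemicontinuous θ) {A : P → Z →L[ℝ] E} {p₀ : P} {z₀ : Z} (hA : ContinuousAt A p₀)
    (hz₀ : FiniteAt θ z₀) (hqual : singSubdiff θ z₀ ∩ {v | A p₀ v = 0} = {0}) :
    ∃ K : ℝ, 0 < K ∧ ∀ᶠ q : P × Z in 𝓝 (p₀, z₀), ∀ v, IsSubgradientAt θ q.2 v →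
      ‖v‖ ≤ K * (‖A q.1 v‖ + 1) := by
  by_contra! hcon
  have hex : ∀ n : ℕ, ∃ (q : P × Z) (v : Z), dist q (p₀, z₀) < 1 / ((n : ℝ) + 1) ∧
      IsSubgradientAt θ q.2 v ∧ ((n : ℝ) + 1) * (‖A q.1 v‖ + 1) < ‖v‖ := by
    intro n
    have hn : (0 : ℝ) < (n : ℝ) + 1 := by positivity
    obtain ⟨q, ⟨v, hv, hlt⟩, hq⟩ := ((hcon ((n : ℝ) + 1) hn).and_eventually
      (Metric.ball_mem_nhds (p₀, z₀) (one_div_pos.2 hn))).exists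
    exact ⟨q, v, hq, hv, hlt⟩
  choose q v hq hv hlt using hex
  have hqlim : Tendsto q atTop (𝓝 (p₀, z₀)) := by
    rw [tendsto_iff_dist_tendsto_zero]
    exact squeeze_zero (fun _ => dist_nonneg) (fun n => (hq n).le)
      tendsto_one_div_add_atTop_nhds_zero_nat
  have hvn : ∀ n : ℕ, (n : ℝ) + 1 < ‖v n‖ := fun n => by
    have : 0 ≤ ((n : ℝ) + 1) * ‖A (q n).1 (v n)‖ := by positivity
    linarith [hlt n]
  have hvpos : ∀ n, 0 < ‖v n‖ := fun n => lt_trans (by positivity) (hvn n)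
  have ht : Tendsto (fun n => ‖v n‖⁻¹) atTop (𝓝 0) := by
    refine squeeze_zero (fun n => (inv_pos.2 (hvpos n)).le) (fun n => ?_)
      (tendsto_one_div_add_atTop_nhds_zero_nat (𝕜 := ℝ))
    rw [one_div]
    exact inv_anti₀ (by positivity) (hvn n).le
  obtain ⟨v₀, hv₀, ψ, hψ, hlim⟩ := (isCompact_sphere (0 : Z) 1).tendsto_subseq
    (x := fun n => ‖v n‖⁻¹ • v n) (fun n => by
      rw [mem_sphere_zero_iff_norm, norm_smul, norm_inv, norm_norm,
        inv_mul_cancel₀ (hvpos n).ne'])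
  have hqψ := hqlim.comp hψ.tendsto_atTop
  have hq1 : Tendsto (fun n => (q (ψ n)).1) atTop (𝓝 p₀) := (continuous_fst.tendsto _).comp hqψ
  have hq2 : Tendsto (fun n => (q (ψ n)).2) atTop (𝓝 z₀) := (continuous_snd.tendsto _).comp hqψ
  have hsing : v₀ ∈ singSubdiff θ z₀ :=
    mem_singSubdiff_of_normal_dom hproper.1 hlsc hz₀ fun z' hz' =>
      inner_nonpos_of_tendsto_normalized hproper hlsc hq2 (fun n => inv_pos.2 (hvpos (ψ n)))
        (ht.comp hψ.tendsto_atTop) hlim (fun n => hv (ψ n)) hz'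
  have hker : A p₀ v₀ = 0 := by
    have h1 : Tendsto (fun n => A (q (ψ n)).1 (‖v (ψ n)‖⁻¹ • v (ψ n))) atTop (𝓝 (A p₀ v₀)) :=
      tendsto_clm_apply (hA.tendsto.comp hq1) hlim
    refine tendsto_nhds_unique h1 (squeeze_zero_norm (fun n => ?_)
      ((tendsto_one_div_add_atTop_nhds_zero_nat (𝕜 := ℝ)).comp hψ.tendsto_atTop))
    rw [map_smul, norm_smul, norm_inv, norm_norm, inv_mul_eq_div, Function.comp_apply,
      div_le_div_iff₀ (hvpos _) (by positivity)]
    have : (0 : ℝ) < (ψ n : ℝ) + 1 := by positivity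
    linarith [hlt (ψ n)]
  have hmem : v₀ ∈ singSubdiff θ z₀ ∩ {v | A p₀ v = 0} := ⟨hsing, hker⟩
  rw [hqual, Set.mem_singleton_iff] at hmem
  rw [mem_sphere_zero_iff_norm, hmem, norm_zero] at hv₀
  exact zero_ne_one hv₀

variable [FiniteDimensional ℝ E]

/-- The exact first-order chain rule for a convex outer function, from a bound on the multipliers
near the reference point. -/
theorem subdiff_eq_image_of_comp {θ : Z → EReal} (hproper : IsProper θ)
    (hlsc : LowerSemicontinuous θ) (hconv : IsConvexFun θ) {f : E → EReal} {g : E → Z} {x : E}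
    (hg : ContDiffAt ℝ 1 g x) (hf : ∀ᶠ x' in 𝓝 x, f x' = θ (g x')) {K : ℝ} (hK : 0 < K)
    (hbound : ∀ᶠ q : E × Z in 𝓝 (x, g x), ∀ v, IsSubgradientAt θ q.2 v →
      ‖v‖ ≤ K * (‖(fderiv ℝ g q.1).adjoint v‖ + 1)) :
    subdiff f x = (fderiv ℝ g x).adjoint '' subdiff θ (g x) := by
  have hdiff : ∀ᶠ x' in 𝓝 x, DifferentiableAt ℝ g x' :=
    (hg.eventually (by simp)).mono fun x' hx' => hx'.differentiableAt one_ne_zero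
  apply Set.Subset.antisymm
  · rintro y ⟨_, xs, ys, hxs, -, hys, hy⟩
    have hgood := hxs.eventually (hf.eventually_nhds.and hdiff.eventually_nhds)
    obtain ⟨N, hN⟩ := eventually_atTop.1 hgood
    have hex : ∀ n : ℕ, ∃ x' z v, dist x' (xs (n + N)) < 1 / ((n : ℝ) + 1) ∧
        dist z (g (xs (n + N))) < 1 / ((n : ℝ) + 1) ∧ v ∈ regSubdiff θ z ∧
        ‖(fderiv ℝ g x').adjoint v - ys (n + N)‖ ≤ 1 / ((n : ℝ) + 1) := by
      intro n
      obtain ⟨h1, h2⟩ := hN (n + N) (Nat.le_add_left N n)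
      have h3 := hys (n + N)
      rw [regSubdiff_congr h1] at h3
      exact exists_regSubdiff_approx_of_comp hlsc hproper.1 h2 h3 (by positivity)
    choose x' z v hx' hz hv hA using hex
    have hshift := tendsto_add_atTop_nat N
    have hzero := tendsto_one_div_add_atTop_nhds_zero_nat (𝕜 := ℝ)
    have hx'lim : Tendsto x' atTop (𝓝 x) :=
      (tendsto_iff_of_dist (squeeze_zero (fun _ => dist_nonneg) (fun n => (hx' n).le) hzero)).2
        (hxs.comp hshift)
    have hzlim : Tendsto z atTop (𝓝 (g x)) :=
      (tendsto_iff_of_dist (squeeze_zero (fun _ => dist_nonneg) (fun n => (hz n).le) hzero)).2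
        (hg.continuousAt.tendsto.comp (hxs.comp hshift))
    have hAlim : Tendsto (fun n => (fderiv ℝ g (x' n)).adjoint (v n)) atTop (𝓝 y) := by
      refine (tendsto_iff_of_dist (squeeze_zero (fun _ => dist_nonneg) (fun n => ?_) hzero)).2
        (hy.comp hshift)
      rw [dist_eq_norm]
      exact hA n
    have hbdd : ∀ᶠ n in atTop, v n ∈ Metric.closedBall (0 : Z) (K * (‖y‖ + 1 + 1)) := by
      filter_upwards [(hx'lim.prodMk_nhds hzlim).eventually hbound,
        hAlim.norm.eventually (gt_mem_nhds (lt_add_one ‖y‖))] with n h1 h2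
      rw [mem_closedBall_zero_iff]
      refine (h1 _ (hconv.isSubgradientAt (hv n))).trans ?_
      exact mul_le_mul_of_nonneg_left (by linarith) hK.le
    obtain ⟨v₀, -, ψ, hψ, hvlim⟩ :=
      tendsto_subseq_of_frequently_bounded Metric.isBounded_closedBall hbdd.frequently
    refine ⟨v₀, ?_, ?_⟩
    · rw [mem_subdiff_iff_isSubgradientAt hproper hlsc hconv]
      exact isSubgradientAt_of_tendsto hproper hlsc (hzlim.comp hψ.tendsto_atTop) hvlim
        (Eventually.of_forall fun n => hconv.isSubgradientAt (hv (ψ n)))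
    · have hcont : ContinuousAt (fun x' => (fderiv ℝ g x').adjoint) x :=
        continuousAt_adjoint (hg.fderiv_right (m := 0) le_rfl).continuousAt
      exact tendsto_nhds_unique
        (tendsto_clm_apply (hcont.tendsto.comp (hx'lim.comp hψ.tendsto_atTop)) hvlim)
        (hAlim.comp hψ.tendsto_atTop)
  · rintro _ ⟨v, hv, rfl⟩
    apply regSubdiff_subset_subdiff
    rw [mem_subdiff_iff_isSubgradientAt hproper hlsc hconv] at hv
    obtain ⟨a, ha, hv⟩ := hv
    rw [regSubdiff_congr hf, mem_regSubdiff_iff (φ := fun x' => θ (g x')) ha]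
    intro ε hε
    have hpos : 0 < ε / (‖v‖ + 1) := by positivity
    filter_upwards [(hg.differentiableAt one_ne_zero).hasFDerivAt.isLittleO.bound hpos]
      with x' hx' c hc
    have h1 := hv (g x') c hc
    have h2 : -inner ℝ v (g x' - g x - fderiv ℝ g x (x' - x)) ≤
        ‖v‖ * (ε / (‖v‖ + 1) * ‖x' - x‖) :=
      (neg_le_abs _).trans ((abs_real_inner_le_norm _ _).trans
        (mul_le_mul_of_nonneg_left hx' (norm_nonneg _)))
    have h3 : ‖v‖ * (ε / (‖v‖ + 1) * ‖x' - x‖) ≤ ε * ‖x' - x‖ := by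
      rw [← mul_assoc]
      refine mul_le_mul_of_nonneg_right ?_ (norm_nonneg _)
      rw [mul_div_assoc', div_le_iff₀ (by positivity)]
      nlinarith [norm_nonneg v]
    rw [ContinuousLinearMap.adjoint_inner_left]
    rw [inner_sub_right] at h2
    linarith

end FirstOrderChainRule

section Amenable

variable {E : Type*} [NormedAddCommGroup E] [InnerProductSpace ℝ E]
variable {W : Type*} [NormedAddCommGroup W] [InnerProductSpace ℝ W]
variable {Z : Type*} [NormedAddCommGroup Z] [InnerProductSpace ℝ Z]

theorem derivX_eq_comp {h : E × W → Z} {x : E} {w : W} (hd : DifferentiableAt ℝ h (x, w)) :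
    derivX h x w = (fderiv ℝ h (x, w)).comp (ContinuousLinearMap.inl ℝ E W) :=
  (hd.hasFDerivAt.comp x (hasFDerivAt_prodMk_left x w)).fderiv

theorem derivW_eq_comp {h : E × W → Z} {x : E} {w : W} (hd : DifferentiableAt ℝ h (x, w)) :
    derivW h x w = (fderiv ℝ h (x, w)).comp (ContinuousLinearMap.inr ℝ E W) :=
  (hd.hasFDerivAt.comp w (hasFDerivAt_prodMk_right x w)).fderiv

theorem contDiffAt_derivX {h : E × W → Z} {x : E} {w : W} (hh : ContDiffAt ℝ 2 h (x, w)) :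
    ContDiffAt ℝ 1 (fun p : E × W => derivX h p.1 p.2) (x, w) := by
  have h1 : (fun p : E × W => derivX h p.1 p.2) =ᶠ[𝓝 (x, w)]
      fun p => (fderiv ℝ h p).comp (ContinuousLinearMap.inl ℝ E W) :=
    (hh.eventually (by simp)).mono fun p hp => derivX_eq_comp (hp.differentiableAt two_ne_zero)
  refine ContDiffAt.congr_of_eventuallyEq ?_ h1
  exact (hh.fderiv_right (m := 1) (by norm_num)).clm_comp contDiffAt_const

variable [FiniteDimensional ℝ E] [FiniteDimensional ℝ Z]

theorem StronglyAmenableVia.contDiffAt {φ : E × W → EReal} {h : E × W → Z} {θ : Z → EReal}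
    {xbar : E} {wbar : W} (hφ : StronglyAmenableVia φ h θ xbar wbar) :
    ContDiffAt ℝ 2 h (xbar, wbar) := by
  obtain ⟨V, hV, hh, -⟩ := hφ.exists_nhds
  exact hh.contDiffAt hV

theorem StronglyAmenableVia.eventually_eq {φ : E × W → EReal} {h : E × W → Z} {θ : Z → EReal}
    {xbar : E} {wbar : W} (hφ : StronglyAmenableVia φ h θ xbar wbar) :
    ∀ᶠ q in 𝓝 (xbar, wbar), φ q = θ (h q) := by
  obtain ⟨V, hV, -, hθ⟩ := hφ.exists_nhds
  filter_upwards [hV] with q hq using hθ q hq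

/-- For a strongly amenable composition, around `(xbar, wbar)` the partial subdifferential is given
by the exact chain rule, and its multipliers are bounded by the subgradients they produce. -/
theorem StronglyAmenableVia.exists_chain_rule {φ : E × W → EReal} {h : E × W → Z} {θ : Z → EReal}
    {xbar : E} {wbar : W} (hφ : StronglyAmenableVia φ h θ xbar wbar) :
    ∃ K : ℝ, ∀ᶠ p : E × W in 𝓝 (xbar, wbar),
      partialSubdiff φ p.1 p.2 = adjX h p.1 p.2 '' subdiff θ (h p) ∧
      ∀ v ∈ subdiff θ (h p), ‖v‖ ≤ K * (‖adjX h p.1 p.2 v‖ + 1) := by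
  have hh := hφ.contDiffAt
  have hfin : FiniteAt θ (h (xbar, wbar)) := by
    have h0 : (0 : Z) ∈ singSubdiff θ (h (xbar, wbar)) ∩ {v | adjX h xbar wbar v = 0} := by
      rw [hφ.qualification]
      rfl
    exact h0.1.1
  have hA : ContinuousAt (fun p : E × W => adjX h p.1 p.2) (xbar, wbar) :=
    continuousAt_adjoint (contDiffAt_derivX hh).continuousAt
  obtain ⟨K, hK, hbound⟩ := exists_subgradient_bound hφ.outer_proper hφ.outer_lsc hA hfin
    hφ.qualification
  have hgraph : Tendsto (fun p => (p, h p)) (𝓝 (xbar, wbar))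
      (𝓝 ((xbar, wbar), h (xbar, wbar))) := tendsto_id.prodMk_nhds hh.continuousAt.tendsto
  refine ⟨K, ?_⟩
  filter_upwards [hgraph.eventually hbound.eventually_nhds, hh.eventually (by simp),
    hφ.eventually_eq.eventually_nhds] with p hp hhp hφp
  have hleft : Tendsto (fun x' : E => (x', p.2)) (𝓝 p.1) (𝓝 p) :=
    tendsto_id.prodMk_nhds tendsto_const_nhds
  have hpull : Tendsto (fun q : E × Z => ((q.1, p.2), q.2)) (𝓝 (p.1, h p)) (𝓝 (p, h p)) :=
    ((continuous_fst.prodMk continuous_const).prodMk continuous_snd).tendsto _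
  refine ⟨?_, fun v hv => hp.self_of_nhds v
    ((mem_subdiff_iff_isSubgradientAt hφ.outer_proper hφ.outer_lsc hφ.outer_convex).1 hv)⟩
  have hg : ContDiffAt ℝ 1 (fun x' => h (x', p.2)) p.1 :=
    (hhp.of_le one_le_two).comp p.1 (contDiffAt_id.prodMk contDiffAt_const)
  exact subdiff_eq_image_of_comp hφ.outer_proper hφ.outer_lsc hφ.outer_convex hg
    (hleft.eventually hφp) hK (hpull.eventually hp)

end Amenable

/-! ### Normals to preimages and to images -/

section NormalCones

open Classical in
/-- The indicator function of a set in the sense of variational analysis: `0` on the set and `+∞`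
outside. -/
def indicatorFun {F : Type*} (Γ : Set F) (z : F) : EReal := if z ∈ Γ then 0 else ⊤

theorem indicatorFun_ne_bot {F : Type*} (Γ : Set F) (z : F) : indicatorFun Γ z ≠ ⊥ := by
  unfold indicatorFun
  split_ifs <;> simp

theorem lowerSemicontinuous_indicatorFun {F : Type*} [TopologicalSpace F] {Γ : Set F}
    (hΓ : IsClosed Γ) :
    LowerSemicontinuous (indicatorFun Γ) := by
  intro z c hc
  by_cases hz : z ∈ Γ
  · refine Eventually.of_forall fun z' => ?_
    rw [indicatorFun, if_pos hz] at hc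
    unfold indicatorFun
    split_ifs
    · exact hc
    · exact hc.trans_le le_top
  · filter_upwards [hΓ.isOpen_compl.mem_nhds hz] with z' hz'
    rw [indicatorFun, if_neg hz] at hc
    rwa [indicatorFun, if_neg hz']

variable {X : Type*} [NormedAddCommGroup X] [InnerProductSpace ℝ X]
variable {Y : Type*} [NormedAddCommGroup Y] [InnerProductSpace ℝ Y]
variable {F : Type*} [NormedAddCommGroup F] [InnerProductSpace ℝ F]

theorem smul_mem_regNormalCone {Γ : Set F} {z η : F} {t : ℝ} (ht : 0 ≤ t)
    (hη : η ∈ regNormalCone Γ z) : t • η ∈ regNormalCone Γ z := by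
  refine ⟨hη.1, fun ε hε => ?_⟩
  filter_upwards [hη.2 (ε / (t + 1)) (by positivity)] with z' hz'
  rw [real_inner_smul_left]
  calc t * inner ℝ η (z' - z) ≤ t * (ε / (t + 1) * ‖z' - z‖) := mul_le_mul_of_nonneg_left hz' ht
    _ = t / (t + 1) * (ε * ‖z' - z‖) := by ring
    _ ≤ 1 * (ε * ‖z' - z‖) := by
      refine mul_le_mul_of_nonneg_right ?_ (by positivity)
      rw [div_le_one (by positivity)]
      linarith
    _ = ε * ‖z' - z‖ := one_mul _

/-- Regular normals pull back along a map that is differentiable at the point and sends `Ω` into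
`Λ` near it. -/
theorem adjoint_mem_regNormalCone [CompleteSpace X] [CompleteSpace Y] {Ω : Set X} {Λ : Set Y}
    {G : X → Y} {G' : X →L[ℝ] Y} {x : X} {y : Y} (hG : HasFDerivAt G G' x) (hx : x ∈ Ω)
    (hmap : ∀ᶠ x' in 𝓝 x, x' ∈ Ω → G x' ∈ Λ) (hy : y ∈ regNormalCone Λ (G x)) :
    G'.adjoint y ∈ regNormalCone Ω x := by
  refine ⟨hx, fun ε hε => ?_⟩
  obtain ⟨C, hC, hbig⟩ := hG.isBigO_sub.exists_pos
  have hG0 : Tendsto G (𝓝[Ω] x) (𝓝[Λ] (G x)) :=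
    tendsto_nhdsWithin_iff.2 ⟨hG.continuousAt.tendsto.mono_left nhdsWithin_le_nhds,
      eventually_nhdsWithin_iff.2 hmap⟩
  have h1 : 0 < ε / (2 * C) := by positivity
  have h2 : 0 < ε / (2 * (‖y‖ + 1)) := by positivity
  filter_upwards [hG0.eventually (hy.2 _ h1), nhdsWithin_le_nhds hbig.bound,
    nhdsWithin_le_nhds (hG.isLittleO.bound h2)] with x' h3 h4 h5
  have h6 : -inner ℝ y (G x' - G x - G' (x' - x)) ≤ ‖y‖ * (ε / (2 * (‖y‖ + 1)) * ‖x' - x‖) :=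
    (neg_le_abs _).trans ((abs_real_inner_le_norm _ _).trans
      (mul_le_mul_of_nonneg_left h5 (norm_nonneg _)))
  have h7 : ‖y‖ * (ε / (2 * (‖y‖ + 1)) * ‖x' - x‖) ≤ ε / 2 * ‖x' - x‖ := by
    rw [← mul_assoc]
    refine mul_le_mul_of_nonneg_right ?_ (norm_nonneg _)
    rw [mul_div_assoc', div_le_div_iff₀ (by positivity) two_pos]
    nlinarith [norm_nonneg y]
  have h8 : ε / (2 * C) * ‖G x' - G x‖ ≤ ε / 2 * ‖x' - x‖ := by
    refine (mul_le_mul_of_nonneg_left h4 h1.le).trans (le_of_eq ?_)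
    field_simp
  rw [inner_sub_right] at h6
  rw [ContinuousLinearMap.adjoint_inner_left]
  linarith

theorem regSubdiff_indicatorFun (Γ : Set F) (z : F) :
    regSubdiff (indicatorFun Γ) z = regNormalCone Γ z := by
  by_cases hz : z ∈ Γ
  · have h0 : indicatorFun Γ z = ((0 : ℝ) : EReal) := by simp [indicatorFun, hz]
    ext v
    rw [mem_regSubdiff_iff h0, regNormalCone, Set.mem_ofPred_eq, and_iff_right hz]
    refine forall₂_congr fun ε _ => ?_
    rw [eventually_nhdsWithin_iff]
    refine eventually_congr (Eventually.of_forall fun z' => ?_)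
    constructor
    · intro h hz'
      have := h 0 (by simp [indicatorFun, hz'])
      linarith
    · intro h c hc
      by_cases hz' : z' ∈ Γ
      · have h1 := h hz'
        have h2 : (0 : ℝ) ≤ c := by simpa [indicatorFun, hz'] using hc
        linarith
      · rw [indicatorFun, if_neg hz', top_le_iff] at hc
        exact absurd hc (EReal.coe_ne_top c)
  · ext v
    constructor
    · rintro ⟨h, -⟩
      exact absurd (by simp [indicatorFun, hz]) h.2
    · rintro ⟨h, -⟩
      exact absurd h hz

variable [FiniteDimensional ℝ X] [FiniteDimensional ℝ F]

/-- Regular normals to the preimage of a closed set are approximated by images of regular normals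
to the set. This is the approximate chain rule for the indicator function of the set. -/
theorem exists_regNormalCone_approx_of_preimage {Γ : Set F} (hΓ : IsClosed Γ) {H : X → F} {x : X}
    (hH : ∀ᶠ x' in 𝓝 x, DifferentiableAt ℝ H x') {ξ : X} (hξ : ξ ∈ regNormalCone (H ⁻¹' Γ) x)
    {ε : ℝ} (hε : 0 < ε) :
    ∃ x' z η, dist x' x < ε ∧ dist z (H x) < ε ∧ η ∈ regNormalCone Γ z ∧
      ‖(fderiv ℝ H x').adjoint η - ξ‖ ≤ ε := by
  rw [← regSubdiff_indicatorFun] at hξ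
  simp_rw [← regSubdiff_indicatorFun Γ]
  exact exists_regSubdiff_approx_of_comp (lowerSemicontinuous_indicatorFun hΓ)
    (indicatorFun_ne_bot Γ) hH hξ hε

variable [FiniteDimensional ℝ Y]

/-- Limiting normals to a set `Λ` which is locally the image under `G` of the preimage of a closed
set `Γ` under `H`. The lifting hypothesis says that points of `Λ` tending to `y₀` have preimages
that accumulate in the fibre of `y₀`. The qualification condition on that fibre keeps the
approximate normals to `Γ` bounded. -/
theorem exists_normal_of_image_preimage {Γ : Set F} (hΓ : IsClosed Γ) {G : X → Y} {H : X → F}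
    {Λ : Set Y} {y₀ : Y}
    (hsmooth : ∀ x, H x ∈ Γ → G x = y₀ → ContDiffAt ℝ 1 G x ∧ ContDiffAt ℝ 1 H x ∧
      ∀ᶠ x' in 𝓝 x, H x' ∈ Γ → G x' ∈ Λ)
    (hlift : ∀ y : ℕ → Y, (∀ k, y k ∈ Λ) → Tendsto y atTop (𝓝 y₀) →
      ∃ (x₀ : X) (x : ℕ → X) (ψ : ℕ → ℕ), StrictMono ψ ∧ Tendsto x atTop (𝓝 x₀) ∧ H x₀ ∈ Γ ∧
        G x₀ = y₀ ∧ ∀ k, H (x k) ∈ Γ ∧ G (x k) = y (ψ k))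
    (hqual : ∀ x, H x ∈ Γ → G x = y₀ → ∀ η ∈ normalCone Γ (H x),
      (fderiv ℝ H x).adjoint η = 0 → η = 0)
    {ν : Y} (hν : ν ∈ normalCone Λ y₀) :
    ∃ x, H x ∈ Γ ∧ G x = y₀ ∧ ∃ η ∈ normalCone Γ (H x),
      (fderiv ℝ H x).adjoint η = (fderiv ℝ G x).adjoint ν := by
  obtain ⟨-, ys, νs, hysΛ, hys, hνs, hνlim⟩ := hν
  obtain ⟨x₀, xs, ψ, hψ, hxs, hx₀, hGx₀, hxsΓ⟩ := hlift ys hysΛ hys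
  obtain ⟨hG, hH, hmap⟩ := hsmooth x₀ hx₀ hGx₀
  have hGd : ∀ᶠ x' in 𝓝 x₀, DifferentiableAt ℝ G x' :=
    (hG.eventually (by simp)).mono fun x' hx' => hx'.differentiableAt one_ne_zero
  have hHd : ∀ᶠ x' in 𝓝 x₀, DifferentiableAt ℝ H x' :=
    (hH.eventually (by simp)).mono fun x' hx' => hx'.differentiableAt one_ne_zero
  obtain ⟨N, hN⟩ := eventually_atTop.1
    (hxs.eventually (hGd.and (hHd.eventually_nhds.and hmap.eventually_nhds)))
  have hex : ∀ n : ℕ, ∃ x' z η, dist x' (xs (n + N)) < 1 / ((n : ℝ) + 1) ∧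
      dist z (H (xs (n + N))) < 1 / ((n : ℝ) + 1) ∧ η ∈ regNormalCone Γ z ∧
      ‖(fderiv ℝ H x').adjoint η - (fderiv ℝ G (xs (n + N))).adjoint (νs (ψ (n + N)))‖ ≤
        1 / ((n : ℝ) + 1) := by
    intro n
    obtain ⟨h1, h2, h3⟩ := hN (n + N) (Nat.le_add_left N n)
    obtain ⟨h4, h5⟩ := hxsΓ (n + N)
    refine exists_regNormalCone_approx_of_preimage hΓ h2 ?_ (by positivity)
    refine adjoint_mem_regNormalCone h1.hasFDerivAt h4 h3 ?_
    rw [h5]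
    exact hνs _
  choose x' z η hx' hz hη hA using hex
  have hshift := tendsto_add_atTop_nat N
  have hzero := tendsto_one_div_add_atTop_nhds_zero_nat (𝕜 := ℝ)
  have hx'lim : Tendsto x' atTop (𝓝 x₀) :=
    (tendsto_iff_of_dist (squeeze_zero (fun _ => dist_nonneg) (fun n => (hx' n).le) hzero)).2
      (hxs.comp hshift)
  have hzlim : Tendsto z atTop (𝓝 (H x₀)) :=
    (tendsto_iff_of_dist (squeeze_zero (fun _ => dist_nonneg) (fun n => (hz n).le) hzero)).2
      (hH.continuousAt.tendsto.comp (hxs.comp hshift))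
  have hG'lim : Tendsto (fun n => (fderiv ℝ G (xs (n + N))).adjoint (νs (ψ (n + N)))) atTop
      (𝓝 ((fderiv ℝ G x₀).adjoint ν)) :=
    tendsto_clm_apply
      ((continuousAt_adjoint (hG.fderiv_right (m := 0) le_rfl).continuousAt).tendsto.comp
        (hxs.comp hshift))
      (hνlim.comp (hψ.tendsto_atTop.comp hshift))
  have hAlim : Tendsto (fun n => (fderiv ℝ H (x' n)).adjoint (η n)) atTop
      (𝓝 ((fderiv ℝ G x₀).adjoint ν)) := by
    refine (tendsto_iff_of_dist (squeeze_zero (fun _ => dist_nonneg) (fun n => ?_) hzero)).2 hG'lim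
    rw [dist_eq_norm]
    exact hA n
  have hH'lim : Tendsto (fun n => (fderiv ℝ H (x' n)).adjoint) atTop
      (𝓝 (fderiv ℝ H x₀).adjoint) :=
    (continuousAt_adjoint (hH.fderiv_right (m := 0) le_rfl).continuousAt).tendsto.comp hx'lim
  -- otherwise the normalized normals would accumulate at a unit normal to `Γ` in the kernel
  have hbdd : ∃ R : ℝ, ∃ᶠ n in atTop, η n ∈ Metric.closedBall (0 : F) R := by
    by_contra! hcon
    have hinf : Tendsto (fun n => ‖η n‖) atTop atTop := by
      refine tendsto_atTop.2 fun R => (hcon R).mono fun n hn => ?_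
      rw [mem_closedBall_zero_iff, not_le] at hn
      exact hn.le
    obtain ⟨η₀, -, χ, hχ, hηlim⟩ := (isCompact_closedBall (0 : F) 1).tendsto_subseq
      (x := fun n => ‖η n‖⁻¹ • η n) (fun n => by
        rw [mem_closedBall_zero_iff, norm_smul, norm_inv, norm_norm]
        exact inv_mul_le_one)
    have hmem : η₀ ∈ normalCone Γ (H x₀) :=
      ⟨hx₀, fun n => z (χ n), fun n => ‖η (χ n)‖⁻¹ • η (χ n), fun n => (hη _).1,
        hzlim.comp hχ.tendsto_atTop,
        fun n => smul_mem_regNormalCone (inv_nonneg.2 (norm_nonneg _)) (hη _), hηlim⟩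
    have hker : (fderiv ℝ H x₀).adjoint η₀ = 0 := by
      have h1 := tendsto_clm_apply (hH'lim.comp hχ.tendsto_atTop) hηlim
      have h2 := (hinf.inv_tendsto_atTop.smul hAlim).comp hχ.tendsto_atTop
      rw [zero_smul] at h2
      refine tendsto_nhds_unique h1 (h2.congr fun n => ?_)
      simp
    have hη₀ : η₀ = 0 := hqual x₀ hx₀ hGx₀ η₀ hmem hker
    have hone : Tendsto (fun n => ‖‖η (χ n)‖⁻¹ • η (χ n)‖) atTop (𝓝 1) := by
      refine tendsto_const_nhds.congr' ?_
      filter_upwards [(hinf.comp hχ.tendsto_atTop).eventually_gt_atTop 0] with n hn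
      have hn : 0 < ‖η (χ n)‖ := hn
      rw [norm_smul, norm_inv, norm_norm, inv_mul_cancel₀ hn.ne']
    have := tendsto_nhds_unique hηlim.norm hone
    rw [hη₀, norm_zero] at this
    exact zero_ne_one this
  obtain ⟨R, hR⟩ := hbdd
  obtain ⟨η₀, -, χ, hχ, hηlim⟩ :=
    tendsto_subseq_of_frequently_bounded Metric.isBounded_closedBall hR
  refine ⟨x₀, hx₀, hGx₀, η₀, ⟨hx₀, fun n => z (χ n), fun n => η (χ n), fun n => (hη _).1,
    hzlim.comp hχ.tendsto_atTop, fun n => hη _, hηlim⟩, ?_⟩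
  exact tendsto_nhds_unique (tendsto_clm_apply (hH'lim.comp hχ.tendsto_atTop) hηlim)
    (hAlim.comp hχ.tendsto_atTop)

end NormalCones

/-! ### Coderivatives of compositions, and the second derivatives of the inner mapping -/

section Adjoint

variable {E : Type*} [NormedAddCommGroup E] [InnerProductSpace ℝ E] [CompleteSpace E]
variable {F : Type*} [NormedAddCommGroup F] [InnerProductSpace ℝ F] [CompleteSpace F]

/-- Over the reals the adjoint is a linear map, and not merely conjugate-linear. -/
def realAdjoint : (E →L[ℝ] F) →L[ℝ] (F →L[ℝ] E) :=
  LinearMap.mkContinuous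
    { toFun := fun A => A.adjoint
      map_add' := fun A B => map_add _ A B
      map_smul' := fun c A => by simp } 1 (fun A => by simp)

theorem realAdjoint_apply (A : E →L[ℝ] F) : realAdjoint A = A.adjoint := rfl

theorem inner_fderiv_adjoint_apply {P : Type*} [NormedAddCommGroup P] [NormedSpace ℝ P]
    {B : P → E →L[ℝ] F} {B' : P →L[ℝ] E →L[ℝ] F} {p : P} (hB : HasFDerivAt B B' p) (v : F)
    (d : P) (e : E) :
    inner ℝ (fderiv ℝ (fun p => (B p).adjoint v) p d) e = inner ℝ v (B' d e) := by
  have h : HasFDerivAt (fun p => (B p).adjoint v) _ p :=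
    (realAdjoint.hasFDerivAt.comp p hB).clm_apply (hasFDerivAt_const v p)
  rw [h.fderiv]
  simp [realAdjoint_apply, ContinuousLinearMap.adjoint_inner_left]

end Adjoint

section Coderivative

variable {P : Type*} [NormedAddCommGroup P] [InnerProductSpace ℝ P] [FiniteDimensional ℝ P]
variable {E : Type*} [NormedAddCommGroup E] [InnerProductSpace ℝ E] [FiniteDimensional ℝ E]
variable {Z : Type*} [NormedAddCommGroup Z] [InnerProductSpace ℝ Z] [FiniteDimensional ℝ Z]

/-- Coderivative of the mapping `p ↦ B(p)^* T(g p)`, tested against directions `d`. Its graph is the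
image under `(p, v) ↦ (p, B(p)^* v)` of the preimage of the graph of `T` under
`(p, v) ↦ (g p, v)`. -/
theorem exists_of_mem_coderivative_adjoint_image {S : P → Set E} {T : Z → Set Z} {g : P → Z}
    {B : P → E →L[ℝ] Z} {p₀ : P} {y₀ : E} {K : ℝ} (hT : IsClosed (setGraph T))
    (hg : ContDiffAt ℝ 1 g p₀) (hB : ContDiffAt ℝ 1 B p₀)
    (hS : ∀ᶠ p in 𝓝 p₀, S p = (B p).adjoint '' T (g p))
    (hK : ∀ᶠ p in 𝓝 p₀, ∀ v ∈ T (g p), ‖v‖ ≤ K * (‖(B p).adjoint v‖ + 1))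
    (hqual : ∀ v ∈ T (g p₀), (B p₀).adjoint v = y₀ → ∀ r ∈ coderivative T (g p₀) v 0,
      (fderiv ℝ g p₀).adjoint r = 0 → r = 0)
    {q : P} {u : E} (hq : q ∈ coderivative S p₀ y₀ u) :
    ∃ v ∈ T (g p₀), (B p₀).adjoint v = y₀ ∧ ∃ r ∈ coderivative T (g p₀) v (B p₀ u),
      ∀ d, inner ℝ q d = inner ℝ r (fderiv ℝ g p₀ d) + inner ℝ v (fderiv ℝ B p₀ d u) := by
  set G : WithLp 2 (P × Z) → WithLp 2 (P × E) :=
    fun x => WithLp.toLp 2 (x.fst, (B x.fst).adjoint x.snd) with hGdef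
  set H : WithLp 2 (P × Z) → WithLp 2 (Z × Z) := fun x => WithLp.toLp 2 (g x.fst, x.snd) with hHdef
  let π : WithLp 2 (P × Z) →L[ℝ] P × Z := (WithLp.prodContinuousLinearEquiv 2 ℝ P Z : _ →L[ℝ] _)
  let π₁ : WithLp 2 (P × Z) →L[ℝ] P := (ContinuousLinearMap.fst ℝ P Z).comp π
  let π₂ : WithLp 2 (P × Z) →L[ℝ] Z := (ContinuousLinearMap.snd ℝ P Z).comp π
  let ιE : P × E →L[ℝ] WithLp 2 (P × E) :=
    ((WithLp.prodContinuousLinearEquiv 2 ℝ P E).symm : _ →L[ℝ] _)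
  let ιZ : Z × Z →L[ℝ] WithLp 2 (Z × Z) :=
    ((WithLp.prodContinuousLinearEquiv 2 ℝ Z Z).symm : _ →L[ℝ] _)
  have hGC : ∀ x : WithLp 2 (P × Z), x.fst = p₀ → ContDiffAt ℝ 1 G x := by
    intro x hx
    have h1 : ContDiffAt ℝ 1 (fun x : WithLp 2 (P × Z) => realAdjoint (B x.fst)) x := by
      have h2 : ContDiffAt ℝ 1 B (π₁ x) := by
        rw [show π₁ x = p₀ from hx]
        exact hB
      exact realAdjoint.contDiff.contDiffAt.comp x (h2.comp x π₁.contDiff.contDiffAt)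
    exact ιE.contDiff.contDiffAt.comp x
      (π₁.contDiff.contDiffAt.prodMk (h1.clm_apply π₂.contDiff.contDiffAt))
  have hHC : ∀ x : WithLp 2 (P × Z), x.fst = p₀ → ContDiffAt ℝ 1 H x := by
    intro x hx
    have h2 : ContDiffAt ℝ 1 g (π₁ x) := by
      rw [show π₁ x = p₀ from hx]
      exact hg
    exact ιZ.contDiff.contDiffAt.comp x
      ((h2.comp x π₁.contDiff.contDiffAt).prodMk π₂.contDiff.contDiffAt)
  have hG' : ∀ x : WithLp 2 (P × Z), x.fst = p₀ → ∀ d, fderiv ℝ G x d =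
      WithLp.toLp 2 (d.fst, (fderiv ℝ B p₀ d.fst).adjoint x.snd + (B p₀).adjoint d.snd) := by
    intro x hx d
    have h2 : HasFDerivAt B (fderiv ℝ B p₀) (π₁ x) := by
      rw [show π₁ x = p₀ from hx]
      exact (hB.differentiableAt one_ne_zero).hasFDerivAt
    have h3 := (realAdjoint.hasFDerivAt.comp x (h2.comp x π₁.hasFDerivAt)).clm_apply
      (π₂.hasFDerivAt (x := x))
    have h4 : HasFDerivAt G _ x := ιE.hasFDerivAt.comp x ((π₁.hasFDerivAt (x := x)).prodMk h3)
    rw [h4.fderiv]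
    subst hx
    exact congrArg (fun t => WithLp.toLp 2 (d.fst, t)) (add_comm _ _)
  have hH' : ∀ x : WithLp 2 (P × Z), x.fst = p₀ → ∀ d, fderiv ℝ H x d =
      WithLp.toLp 2 (fderiv ℝ g p₀ d.fst, d.snd) := by
    intro x hx d
    have h2 : HasFDerivAt g (fderiv ℝ g p₀) (π₁ x) := by
      rw [show π₁ x = p₀ from hx]
      exact (hg.differentiableAt one_ne_zero).hasFDerivAt
    have h4 : HasFDerivAt H _ x := ιZ.hasFDerivAt.comp x
      ((h2.comp x π₁.hasFDerivAt).prodMk (π₂.hasFDerivAt (x := x)))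
    rw [h4.fderiv]
    rfl
  have hfib : ∀ x : WithLp 2 (P × Z), G x = WithLp.toLp 2 (p₀, y₀) →
      x.fst = p₀ ∧ (B p₀).adjoint x.snd = y₀ := by
    intro x hx
    have h1 : x.fst = p₀ := congrArg WithLp.fst hx
    have h2 : (B x.fst).adjoint x.snd = y₀ := congrArg WithLp.snd hx
    rw [h1] at h2
    exact ⟨h1, h2⟩
  have hA : ContinuousAt (fun p => (B p).adjoint) p₀ := continuousAt_adjoint hB.continuousAt
  have hmain := exists_normal_of_image_preimage (Γ := setGraph T) (Λ := setGraph S) (G := G)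
    (H := H) (y₀ := WithLp.toLp 2 (p₀, y₀)) hT ?_ ?_ ?_ hq
  · obtain ⟨x, hxΓ, hx, η, hη, hηeq⟩ := hmain
    obtain ⟨hx1, hx2⟩ := hfib x hx
    have hHx : H x = WithLp.toLp 2 (g p₀, x.snd) := by rw [hHdef, ← hx1]
    have hweak : ∀ (d : P) (e : Z), inner ℝ η.fst (fderiv ℝ g p₀ d) + inner ℝ η.snd e =
        inner ℝ q d + inner ℝ (-u) ((fderiv ℝ B p₀ d).adjoint x.snd + (B p₀).adjoint e) := by
      intro d e
      have h1 := congrArg (fun ξ => inner ℝ ξ (WithLp.toLp 2 (d, e))) hηeq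
      simp only [ContinuousLinearMap.adjoint_inner_left] at h1
      rw [hG' x hx1, hH' x hx1, WithLp.prod_inner_apply, WithLp.prod_inner_apply] at h1
      exact h1
    -- directions `(0, e)` determine the second component of the normal
    have hsnd : η.snd = -(B p₀ u) := by
      refine ext_inner_right ℝ fun e => ?_
      have := hweak 0 e
      simpa [ContinuousLinearMap.adjoint_inner_right] using this
    refine ⟨x.snd, ?_, hx2, η.fst, ?_, fun d => ?_⟩
    · rw [hHx] at hxΓ
      exact hxΓ
    · rw [hHx] at hη
      have h1 : η = WithLp.toLp 2 (η.fst, -(B p₀ u)) := by rw [← hsnd]; rfl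
      rw [h1] at hη
      exact hη
    · have := hweak d 0
      rw [map_zero, add_zero, inner_zero_right, add_zero, inner_neg_left,
        ContinuousLinearMap.adjoint_inner_right, real_inner_comm x.snd] at this
      linarith
  · intro x _ hx
    obtain ⟨hx1, -⟩ := hfib x hx
    refine ⟨hGC x hx1, hHC x hx1, ?_⟩
    have h1 : Tendsto π₁ (𝓝 x) (𝓝 p₀) := by
      have := π₁.continuous.tendsto x
      rwa [show π₁ x = p₀ from hx1] at this
    filter_upwards [h1.eventually hS] with x' hx' hmem
    have h2 : (B x'.fst).adjoint x'.snd ∈ S x'.fst := by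
      rw [show S x'.fst = _ from hx']
      exact ⟨x'.snd, hmem, rfl⟩
    exact h2
  -- points of the graph lift to pairs with a bounded, hence subconvergent, multiplier
  · intro y hy hylim
    have hy1 : Tendsto (fun k => (y k).fst) atTop (𝓝 p₀) :=
      ((WithLp.prod_continuous_ofLp 2 P E).fst.tendsto _).comp hylim
    have hy2 : Tendsto (fun k => (y k).snd) atTop (𝓝 y₀) :=
      ((WithLp.prod_continuous_ofLp 2 P E).snd.tendsto _).comp hylim
    obtain ⟨N, hN⟩ := eventually_atTop.1 ((hy1.eventually (hS.and hK)).and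
      (hy2.norm.eventually (gt_mem_nhds (lt_add_one ‖y₀‖))))
    have hex : ∀ k : ℕ, ∃ v ∈ T (g (y (k + N)).fst), (B (y (k + N)).fst).adjoint v = (y (k + N)).snd
        ∧ v ∈ Metric.closedBall (0 : Z) (|K| * (‖y₀‖ + 1 + 1)) := by
      intro k
      obtain ⟨⟨h1, h2⟩, h3⟩ := hN (k + N) (Nat.le_add_left N k)
      have h4 : (y (k + N)).snd ∈ S (y (k + N)).fst := hy (k + N)
      rw [h1] at h4
      obtain ⟨v, hv, hvy⟩ := h4
      refine ⟨v, hv, hvy, ?_⟩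
      rw [mem_closedBall_zero_iff]
      refine (h2 v hv).trans ?_
      rw [hvy]
      exact (mul_le_mul_of_nonneg_right (le_abs_self K) (by positivity)).trans
        (mul_le_mul_of_nonneg_left (by linarith) (abs_nonneg K))
    choose v hvT hvy hvb using hex
    obtain ⟨v₀, -, ψ, hψ, hvlim⟩ := (isCompact_closedBall (0 : Z) _).tendsto_subseq hvb
    have hshift := (tendsto_add_atTop_nat N).comp hψ.tendsto_atTop
    have hp := hy1.comp hshift
    refine ⟨WithLp.toLp 2 (p₀, v₀), fun k => WithLp.toLp 2 ((y (ψ k + N)).fst, v (ψ k)),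
      fun k => ψ k + N, fun a b hab => Nat.add_lt_add_right (hψ hab) N,
      ((WithLp.prod_continuous_toLp 2 P Z).tendsto (p₀, v₀)).comp (hp.prodMk_nhds hvlim),
      ?_, ?_, fun k => ⟨hvT (ψ k), ?_⟩⟩
    · have h1 : Tendsto (fun k => WithLp.toLp 2 (g (y (ψ k + N)).fst, v (ψ k))) atTop
          (𝓝 (WithLp.toLp 2 (g p₀, v₀))) :=
        ((WithLp.prod_continuous_toLp 2 Z Z).tendsto (g p₀, v₀)).comp
          ((hg.continuousAt.tendsto.comp hp).prodMk_nhds hvlim)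
      exact hT.mem_of_tendsto h1 (Eventually.of_forall fun k => hvT (ψ k))
    · have h1 := tendsto_nhds_unique (tendsto_clm_apply (hA.tendsto.comp hp) hvlim)
        ((hy2.comp hshift).congr fun k => (hvy (ψ k)).symm)
      exact congrArg (fun t => WithLp.toLp 2 (p₀, t)) h1
    · exact congrArg (fun t => WithLp.toLp 2 ((y (ψ k + N)).fst, t)) (hvy (ψ k))
  · intro x hxΓ hx η hη hker
    obtain ⟨hx1, hx2⟩ := hfib x hx
    have hHx : H x = WithLp.toLp 2 (g p₀, x.snd) := by rw [hHdef, ← hx1]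
    have hweak : ∀ (d : P) (e : Z), inner ℝ η.fst (fderiv ℝ g p₀ d) + inner ℝ η.snd e = 0 := by
      intro d e
      have h1 := congrArg (fun ξ => inner ℝ ξ (WithLp.toLp 2 (d, e))) hker
      simp only [ContinuousLinearMap.adjoint_inner_left, inner_zero_left] at h1
      rw [hH' x hx1, WithLp.prod_inner_apply] at h1
      exact h1
    have hsnd : η.snd = 0 := by
      refine ext_inner_right ℝ fun e => ?_
      simpa using hweak 0 e
    have h1 : η = WithLp.toLp 2 (η.fst, -0) := by rw [neg_zero, ← hsnd]; rfl
    have hfst : η.fst = 0 := by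
      rw [hHx] at hxΓ hη
      refine hqual x.snd hxΓ hx2 η.fst ?_ ?_
      · rw [h1] at hη
        exact hη
      · refine ext_inner_right ℝ fun d => ?_
        rw [ContinuousLinearMap.adjoint_inner_left, inner_zero_left]
        simpa using hweak d 0
    rw [h1, hfst, neg_zero]
    rfl

end Coderivative

section Hessian

variable {E : Type*} [NormedAddCommGroup E] [InnerProductSpace ℝ E]
variable {W : Type*} [NormedAddCommGroup W] [InnerProductSpace ℝ W]
variable {Z : Type*} [NormedAddCommGroup Z] [InnerProductSpace ℝ Z]

theorem hasFDerivAt_derivX {h : E × W → Z} {x : E} {w : W} (hh : ContDiffAt ℝ 2 h (x, w)) :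
    HasFDerivAt (fun p : E × W => derivX h p.1 p.2)
      (((ContinuousLinearMap.compL ℝ E (E × W) Z).flip (ContinuousLinearMap.inl ℝ E W)).comp
        (fderiv ℝ (fderiv ℝ h) (x, w))) (x, w) := by
  have h1 : (fun p : E × W => derivX h p.1 p.2) =ᶠ[𝓝 (x, w)]
      fun p => (fderiv ℝ h p).comp (ContinuousLinearMap.inl ℝ E W) :=
    (hh.eventually (by simp)).mono fun p hp => derivX_eq_comp (hp.differentiableAt two_ne_zero)
  refine HasFDerivAt.congr_of_eventuallyEq ?_ h1
  exact ((ContinuousLinearMap.compL ℝ E (E × W) Z).flip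
    (ContinuousLinearMap.inl ℝ E W)).hasFDerivAt.comp (x, w) ((hh.fderiv_right (m := 1)
      (by norm_num)).differentiableAt one_ne_zero).hasFDerivAt

theorem hasFDerivAt_derivW {h : E × W → Z} {x : E} {w : W} (hh : ContDiffAt ℝ 2 h (x, w)) :
    HasFDerivAt (fun p : E × W => derivW h p.1 p.2)
      (((ContinuousLinearMap.compL ℝ W (E × W) Z).flip (ContinuousLinearMap.inr ℝ E W)).comp
        (fderiv ℝ (fderiv ℝ h) (x, w))) (x, w) := by
  have h1 : (fun p : E × W => derivW h p.1 p.2) =ᶠ[𝓝 (x, w)]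
      fun p => (fderiv ℝ h p).comp (ContinuousLinearMap.inr ℝ E W) :=
    (hh.eventually (by simp)).mono fun p hp => derivW_eq_comp (hp.differentiableAt two_ne_zero)
  refine HasFDerivAt.congr_of_eventuallyEq ?_ h1
  exact ((ContinuousLinearMap.compL ℝ W (E × W) Z).flip
    (ContinuousLinearMap.inr ℝ E W)).hasFDerivAt.comp (x, w) ((hh.fderiv_right (m := 1)
      (by norm_num)).differentiableAt one_ne_zero).hasFDerivAt

variable [FiniteDimensional ℝ Z]

theorem gradient_inner_eq_adjoint [FiniteDimensional ℝ E] {f : E → Z} {x : E}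
    (hf : DifferentiableAt ℝ f x) (v : Z) :
    gradient (fun x' => inner ℝ v (f x')) x = (fderiv ℝ f x).adjoint v := by
  refine HasGradientAt.gradient ?_
  rw [hasGradientAt_iff_hasFDerivAt]
  refine ((innerSL ℝ v).hasFDerivAt.comp x hf.hasFDerivAt).congr_fderiv ?_
  ext d
  simp [ContinuousLinearMap.adjoint_inner_left]

/-- The partial Hessian of `⟨v, h⟩` in `x`, with the second derivative of `h` in the order in which
it comes out of differentiating `∇ₓh(x, w) u`. -/
theorem inner_hessXX [FiniteDimensional ℝ E] {h : E × W → Z} {x : E} {w : W}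
    (hh : ContDiffAt ℝ 2 h (x, w)) (v : Z) (u d : E) :
    inner ℝ (hessXX h v x w u) d = inner ℝ v (fderiv ℝ (fderiv ℝ h) (x, w) (d, 0) (u, 0)) := by
  have hleft : Tendsto (fun x' : E => (x', w)) (𝓝 x) (𝓝 (x, w)) :=
    tendsto_id.prodMk_nhds tendsto_const_nhds
  have h1 : (fun x' => gradient (fun x'' => inner ℝ v (h (x'', w))) x') =ᶠ[𝓝 x]
      fun x' => (derivX h x' w).adjoint v := by
    filter_upwards [hleft.eventually (hh.eventually (by simp))] with x' hx'
    exact gradient_inner_eq_adjoint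
      ((hx'.differentiableAt two_ne_zero).comp x' (hasFDerivAt_prodMk_left x' w).differentiableAt) v
  have h2 := HasFDerivAt.comp (g := fun p : E × W => derivX h p.1 p.2) x
    (hasFDerivAt_derivX hh) (hasFDerivAt_prodMk_left (𝕜 := ℝ) x w)
  have hsymm : IsSymmSndFDerivAt ℝ h (x, w) := hh.isSymmSndFDerivAt (by simp)
  rw [hessXX, h1.fderiv_eq, inner_fderiv_adjoint_apply (B := fun x' => derivX h x' w) h2 v,
    hsymm (d, 0) (u, 0)]
  simp

/-- The mixed Hessian of `⟨v, h⟩`, with the derivatives in the same order as in `inner_hessXX`. -/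
theorem inner_hessXW [FiniteDimensional ℝ W] {h : E × W → Z} {x : E} {w : W}
    (hh : ContDiffAt ℝ 2 h (x, w)) (v : Z) (u : E) (e : W) :
    inner ℝ (hessXW h v x w u) e = inner ℝ v (fderiv ℝ (fderiv ℝ h) (x, w) (0, e) (u, 0)) := by
  have hleft : Tendsto (fun x' : E => (x', w)) (𝓝 x) (𝓝 (x, w)) :=
    tendsto_id.prodMk_nhds tendsto_const_nhds
  have h1 : (fun x' => gradient (fun w' => inner ℝ v (h (x', w'))) w) =ᶠ[𝓝 x]
      fun x' => (derivW h x' w).adjoint v := by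
    filter_upwards [hleft.eventually (hh.eventually (by simp))] with x' hx'
    exact gradient_inner_eq_adjoint
      ((hx'.differentiableAt two_ne_zero).comp w (hasFDerivAt_prodMk_right x' w).differentiableAt) v
  have h2 := HasFDerivAt.comp (g := fun p : E × W => derivW h p.1 p.2) x
    (hasFDerivAt_derivW hh) (hasFDerivAt_prodMk_left (𝕜 := ℝ) x w)
  have hsymm : IsSymmSndFDerivAt ℝ h (x, w) := hh.isSymmSndFDerivAt (by simp)
  rw [hessXW, h1.fderiv_eq, inner_fderiv_adjoint_apply (B := fun x' => derivW h x' w) h2 v,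
    hsymm (0, e) (u, 0)]
  simp

end Hessian

/-! ### The second-order chain rules -/

section SecondOrderChainRule

variable {E : Type*} [NormedAddCommGroup E] [InnerProductSpace ℝ E] [FiniteDimensional ℝ E]
variable {W : Type*} [NormedAddCommGroup W] [InnerProductSpace ℝ W]
variable {Z : Type*} [NormedAddCommGroup Z] [InnerProductSpace ℝ Z] [FiniteDimensional ℝ Z]
variable {φ : E × W → EReal} {h : E × W → Z} {θ : Z → EReal} {xbar : E} {wbar : W} {ybar : E}

theorem StronglyAmenableVia.multipliers_nonempty (hφ : StronglyAmenableVia φ h θ xbar wbar)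
    (hy : ybar ∈ partialSubdiff φ xbar wbar) : (multipliers h θ xbar wbar ybar).Nonempty := by
  obtain ⟨K, hK⟩ := hφ.exists_chain_rule
  rw [hK.self_of_nhds.1] at hy
  obtain ⟨v, hv, hvy⟩ := hy
  exact ⟨v, hv, hvy⟩

theorem StronglyAmenableVia.exists_of_mem_partialSubdiff2
    (hφ : StronglyAmenableVia φ h θ xbar wbar)
    (hqc : ∀ v ∈ multipliers h θ xbar wbar ybar,
      subdiff2 θ (h (xbar, wbar)) v 0 ∩ {p | adjX h xbar wbar p = 0} = {0})
    {u q : E} (hq : q ∈ partialSubdiff2 φ xbar wbar ybar u) :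
    ∃ v ∈ multipliers h θ xbar wbar ybar,
      ∃ r ∈ subdiff2 θ (h (xbar, wbar)) v (derivX h xbar wbar u),
        hessXX h v xbar wbar u + adjX h xbar wbar r = q := by
  have hh := hφ.contDiffAt
  have hleft : Tendsto (fun x : E => (x, wbar)) (𝓝 xbar) (𝓝 (xbar, wbar)) :=
    tendsto_id.prodMk_nhds tendsto_const_nhds
  have hleftC : ContDiffAt ℝ 1 (fun x : E => (x, wbar)) xbar :=
    contDiffAt_id.prodMk contDiffAt_const
  obtain ⟨K, hK⟩ := hφ.exists_chain_rule
  obtain ⟨v, hv, hvy, r, hr, hqr⟩ := exists_of_mem_coderivative_adjoint_image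
    (S := fun x => partialSubdiff φ x wbar) (T := subdiff θ) (g := fun x => h (x, wbar))
    (B := fun x => derivX h x wbar) (p₀ := xbar) (y₀ := ybar) (K := K)
    (isClosed_setGraph_subdiff hφ.outer_proper hφ.outer_lsc hφ.outer_convex)
    ((hh.of_le one_le_two).comp xbar hleftC)
    (ContDiffAt.comp (g := fun p : E × W => derivX h p.1 p.2) xbar (contDiffAt_derivX hh) hleftC)
    (hleft.eventually (hK.mono fun p hp => hp.1)) (hleft.eventually (hK.mono fun p hp => hp.2))
    (fun v hv hvy r hr hker => by
      have hmem : r ∈ subdiff2 θ (h (xbar, wbar)) v 0 ∩ {p | adjX h xbar wbar p = 0} := ⟨hr, hker⟩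
      rwa [hqc v ⟨hv, hvy⟩] at hmem) hq
  refine ⟨v, ⟨hv, hvy⟩, r, hr, ext_inner_right ℝ fun d => ?_⟩
  have hB : fderiv ℝ (fun x => derivX h x wbar) xbar d u =
      fderiv ℝ (fderiv ℝ h) (xbar, wbar) (d, 0) (u, 0) := by
    have h1 := HasFDerivAt.comp (g := fun p : E × W => derivX h p.1 p.2) xbar
      (hasFDerivAt_derivX hh) (hasFDerivAt_prodMk_left (𝕜 := ℝ) xbar wbar)
    have h2 : fderiv ℝ (fun x => derivX h x wbar) xbar = _ := h1.fderiv
    rw [h2]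
    rfl
  rw [hqr d, hB, inner_add_left, inner_hessXX hh, adjX, ContinuousLinearMap.adjoint_inner_left,
    add_comm]
  rfl

theorem StronglyAmenableVia.exists_of_mem_extPartialSubdiff2 [FiniteDimensional ℝ W]
    (hφ : StronglyAmenableVia φ h θ xbar wbar)
    (hqc : ∀ v ∈ multipliers h θ xbar wbar ybar,
      subdiff2 θ (h (xbar, wbar)) v 0 ∩ {p | adjX h xbar wbar p = 0} = {0})
    {u : E} {q : WithLp 2 (E × W)} (hq : q ∈ extPartialSubdiff2 φ xbar wbar ybar u) :
    ∃ v ∈ multipliers h θ xbar wbar ybar,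
      ∃ r ∈ subdiff2 θ (h (xbar, wbar)) v (derivX h xbar wbar u),
        WithLp.toLp 2 (hessXX h v xbar wbar u + adjX h xbar wbar r,
          hessXW h v xbar wbar u + adjW h xbar wbar r) = q := by
  have hh := hφ.contDiffAt
  let e : WithLp 2 (E × W) ≃L[ℝ] E × W := WithLp.prodContinuousLinearEquiv 2 ℝ E W
  set p₀ : WithLp 2 (E × W) := WithLp.toLp 2 (xbar, wbar) with hp₀
  have he : Tendsto e (𝓝 p₀) (𝓝 (xbar, wbar)) := e.continuous.tendsto p₀
  have heC : ContDiffAt ℝ 1 e p₀ := e.contDiff.contDiffAt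
  have hhd : DifferentiableAt ℝ h (xbar, wbar) := hh.differentiableAt two_ne_zero
  have hg' : ∀ d : WithLp 2 (E × W), fderiv ℝ (fun p : WithLp 2 (E × W) => h (p.fst, p.snd)) p₀ d =
      derivX h xbar wbar d.fst + derivW h xbar wbar d.snd := by
    intro d
    have h1 : HasFDerivAt (fun p : WithLp 2 (E × W) => h (p.fst, p.snd)) _ p₀ :=
      HasFDerivAt.comp (g := h) p₀ hhd.hasFDerivAt e.hasFDerivAt
    rw [h1.fderiv, derivX_eq_comp hhd, derivW_eq_comp hhd]
    simp only [ContinuousLinearMap.comp_apply, ← map_add, ContinuousLinearMap.inl_apply,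
      ContinuousLinearMap.inr_apply, Prod.mk_add_mk, add_zero, zero_add]
    rfl
  have hB' : ∀ d : WithLp 2 (E × W),
      fderiv ℝ (fun p : WithLp 2 (E × W) => derivX h p.fst p.snd) p₀ d u =
      fderiv ℝ (fderiv ℝ h) (xbar, wbar) (d.fst, d.snd) (u, 0) := by
    intro d
    have h1 : HasFDerivAt (fun p : WithLp 2 (E × W) => derivX h p.fst p.snd) _ p₀ :=
      HasFDerivAt.comp (g := fun p : E × W => derivX h p.1 p.2) p₀ (hasFDerivAt_derivX hh)
        e.hasFDerivAt
    rw [h1.fderiv]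
    rfl
  obtain ⟨K, hK⟩ := hφ.exists_chain_rule
  obtain ⟨v, hv, hvy, r, hr, hqr⟩ := exists_of_mem_coderivative_adjoint_image
    (S := fun p : WithLp 2 (E × W) => partialSubdiff φ p.fst p.snd) (T := subdiff θ)
    (g := fun p : WithLp 2 (E × W) => h (p.fst, p.snd))
    (B := fun p : WithLp 2 (E × W) => derivX h p.fst p.snd) (p₀ := p₀) (y₀ := ybar) (K := K)
    (isClosed_setGraph_subdiff hφ.outer_proper hφ.outer_lsc hφ.outer_convex)
    (ContDiffAt.comp (g := h) p₀ (hh.of_le one_le_two) heC)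
    (ContDiffAt.comp (g := fun p : E × W => derivX h p.1 p.2) p₀ (contDiffAt_derivX hh) heC)
    (he.eventually (hK.mono fun p hp => hp.1)) (he.eventually (hK.mono fun p hp => hp.2))
    (fun v hv hvy r hr hker => by
      have hkerX : adjX h xbar wbar r = 0 := by
        refine ext_inner_right ℝ fun d => ?_
        have h1 := congrArg (fun ξ => inner ℝ ξ (WithLp.toLp 2 (d, (0 : W)))) hker
        simp only [ContinuousLinearMap.adjoint_inner_left, inner_zero_left] at h1
        rw [hg', show (WithLp.toLp 2 (d, (0 : W))).snd = 0 from rfl, map_zero, add_zero] at h1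
        rw [adjX, ContinuousLinearMap.adjoint_inner_left, inner_zero_left]
        exact h1
      have hmem : r ∈ subdiff2 θ (h (xbar, wbar)) v 0 ∩ {p | adjX h xbar wbar p = 0} := ⟨hr, hkerX⟩
      rwa [hqc v ⟨hv, hvy⟩] at hmem) hq
  refine ⟨v, ⟨hv, hvy⟩, r, hr, ext_inner_right ℝ fun d => ?_⟩
  -- the mixed second derivative splits along the two components of the direction
  have hsplit : fderiv ℝ (fderiv ℝ h) (xbar, wbar) (d.fst, d.snd) (u, 0) =
      fderiv ℝ (fderiv ℝ h) (xbar, wbar) (d.fst, 0) (u, 0) +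
        fderiv ℝ (fderiv ℝ h) (xbar, wbar) (0, d.snd) (u, 0) := by
    rw [← add_apply, ← map_add, Prod.mk_add_mk, add_zero, zero_add]
  rw [hqr d, hB', hg', hsplit, WithLp.prod_inner_apply]
  change inner ℝ (hessXX h v xbar wbar u + adjX h xbar wbar r) d.fst +
    inner ℝ (hessXW h v xbar wbar u + adjW h xbar wbar r) d.snd = _
  simp only [inner_add_left, inner_add_right, inner_hessXX hh, inner_hessXW hh, adjX, adjW,
    ContinuousLinearMap.adjoint_inner_left]
  ring

end SecondOrderChainRule

end VarAnal

end

theorem theorem3p3 {n d m : ℕ}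
    (φ : EuclideanSpace ℝ (Fin n) × EuclideanSpace ℝ (Fin d) → EReal)
    (h : EuclideanSpace ℝ (Fin n) × EuclideanSpace ℝ (Fin d) → EuclideanSpace ℝ (Fin m))
    (θ : EuclideanSpace ℝ (Fin m) → EReal)
    (xbar : EuclideanSpace ℝ (Fin n)) (wbar : EuclideanSpace ℝ (Fin d))
    (hφ : VarAnal.StronglyAmenableVia φ h θ xbar wbar)
    (ybar : EuclideanSpace ℝ (Fin n)) (hy : ybar ∈ VarAnal.partialSubdiff φ xbar wbar)
    (hqc : ∀ v ∈ VarAnal.multipliers h θ xbar wbar ybar,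
      VarAnal.subdiff2 θ (h (xbar, wbar)) v 0 ∩ {p | VarAnal.adjX h xbar wbar p = 0} = {0}) :
    (VarAnal.multipliers h θ xbar wbar ybar).Nonempty ∧
    ∀ u : EuclideanSpace ℝ (Fin n),
      VarAnal.partialSubdiff2 φ xbar wbar ybar u ⊆
        ⋃ v ∈ VarAnal.multipliers h θ xbar wbar ybar,
          (fun p => VarAnal.hessXX h v xbar wbar u + VarAnal.adjX h xbar wbar p) ''
            VarAnal.subdiff2 θ (h (xbar, wbar)) v (VarAnal.derivX h xbar wbar u) ∧
      VarAnal.extPartialSubdiff2 φ xbar wbar ybar u ⊆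
        ⋃ v ∈ VarAnal.multipliers h θ xbar wbar ybar,
          (fun p => WithLp.toLp 2
            (VarAnal.hessXX h v xbar wbar u + VarAnal.adjX h xbar wbar p,
             VarAnal.hessXW h v xbar wbar u + VarAnal.adjW h xbar wbar p)) ''
            VarAnal.subdiff2 θ (h (xbar, wbar)) v (VarAnal.derivX h xbar wbar u) := by
  refine ⟨hφ.multipliers_nonempty hy, fun u => ⟨fun q hq => ?_, fun q hq => ?_⟩⟩
  · obtain ⟨v, hv, r, hr, rfl⟩ := hφ.exists_of_mem_partialSubdiff2 hqc hq
    exact Set.mem_biUnion hv ⟨r, hr, rfl⟩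
  · obtain ⟨v, hv, r, hr, rfl⟩ := hφ.exists_of_mem_extPartialSubdiff2 hqc hq
    exact Set.mem_biUnion hv ⟨r, hr, rfl⟩
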